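/- Fix a sample size $n$ and a response vector $Y=(Y_1,\dots,Y_n)\in\{0,1\}^n$. For each dimension $p\ge p_0$ let $X_p$ be a real $n\times p$ design matrix with rows $X_{p,i}^T$, let $Q_p$ be a symmetric positive definite $p\times p$ matrix and let $v_p\in\mathbb R^p$. Write $\mathcal D_p=(v_p,Q_p,X_p,Y)$ and let $\Phi$ be the standard normal distribution function. The posterior distribution $\Pi_p$ of the probit model with prior $N_p(v_p,Q_p^{-1})$ is the probability measure on $\mathbb R^p$ with Lebesgue density proportional to $$\Big\{\prod_{i=1}^n \Phi(X_{p,i}^T\beta)^{Y_i}\,\big(1-\Phi(X_{p,i}^T\beta)\big)^{1-Y_i}\Big\}\exp\Big\{-\tfrac12(\beta-v_p)^TQ_p(\beta-v_p)\Big\}.$$ The Albert and Chib chain for $\mathcal D_p$ is the Markov chain on $\mathbb R^p$ which moves from $\beta$ as follows: draw $Z_1,\dots,Z_n$ independently, $Z_i$ having the $N(X_{p,i}^T\beta,1)$ distribution truncated to $(0,\infty)$ if $Y_i=1$ and to $(-\infty,0)$ if $Y_i=0$; then draw the new state from $N_p\big(\Sigma_p^{-1}(X_p^TZ+Q_pv_p),\Sigma_p^{-1}\big)$,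 where $\Sigma_p=X_p^TX_p+Q_p$. Let $K_p$ be its transition function. Its geometric convergence rate $\rho_*(\mathcal D_p)$ is the infimum of all $\rho\in[0,1]$ for which there is a function $M:\mathbb R^p\to[0,\infty)$ with $\|K_p^m(\beta,\cdot)-\Pi_p\|_{TV}\le M(\beta)\rho^m$ for all $\beta\in\mathbb R^p$ and all $m\in\mathbb N$. Assume that (B1) $X_p$ has full row rank (rank $n$) for every $p\ge p_0$; (B2) there is a finite constant $c>0$ such that $\lambda_{\max}(X_pQ_p^{-1}X_p^T)<c$ for every $p\ge p_0$. Then there is a constant $\rho<1$, which can be chosen independently of the prior means, such that for every sequence of prior means $(v_p)_{p\ge p_0}$ one has $\rho_*(\mathcal D_p)\le\rho$ for all $p\ge p_0$. -/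

import Mathlib

open MeasureTheory ProbabilityTheory Matrix

/-! ### Geometric convergence rate of a Markov chain -/

section Rate

/-- Total variation distance `sup_A |μ(A) - ν(A)|` between two probability measures. -/
noncomputable def tvDist {S : Type*} [MeasurableSpace S] (μ ν : Measure S) : ℝ :=
  ⨆ A : {A : Set S // MeasurableSet A}, |μ.real A.1 - ν.real A.1|

/-- The chain with Markov transition function `K` converges to `π` at the geometric rate `ρ`:
`‖K^m(x, ·) - π‖_TV ≤ M(x) ρ^m` for all states `x` and all `m`, for some `M : S → [0, ∞)`.
Here `K ^ m` is the `m`-step transition function (powers are for composition of kernels). -/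
def ConvergesAtRate {S : Type*} [MeasurableSpace S] (K : Kernel S S) (π : Measure S)
    (ρ : ℝ) : Prop :=
  ∃ M : S → ℝ, (∀ x, 0 ≤ M x) ∧ ∀ (x : S) (m : ℕ), tvDist ((K ^ m) x) π ≤ M x * ρ ^ m

/-- The geometric convergence rate `ρ_*`: the infimum of all `ρ ∈ [0, 1]` at which the chain
converges geometrically (`ρ = 1` always qualifies). -/
noncomputable def geomRate {S : Type*} [MeasurableSpace S] (K : Kernel S S)
    (π : Measure S) : ℝ :=
  sInf {ρ : ℝ | ρ ∈ Set.Icc (0 : ℝ) 1 ∧ ConvergesAtRate K π ρ}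

end Rate

/-! ### The posterior of the Bayesian probit model -/

section Posterior

/-- The standard normal distribution function `Φ`. -/
noncomputable def stdNormalCDF (t : ℝ) : ℝ := cdf (gaussianReal 0 1) t

/-- The probit likelihood `∏ i, Φ(X_iᵀ β)^{Y_i} (1 - Φ(X_iᵀ β))^{1 - Y_i}`; the binary response
`Y_i = 1` is encoded by `true`, and `Y_i = 0` by `false`. -/
noncomputable def probitLikelihood {n p : ℕ} (X : Matrix (Fin n) (Fin p) ℝ) (Y : Fin n → Bool)
    (β : EuclideanSpace ℝ (Fin p)) : ℝ :=
  ∏ i, if Y i then stdNormalCDF ((X *ᵥ β.ofLp) i) else 1 - stdNormalCDF ((X *ᵥ β.ofLp) i)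

/-- The unnormalized Gaussian prior density `exp(-(β - v)ᵀ Q (β - v) / 2)`. -/
noncomputable def priorDensity {p : ℕ} (Q : Matrix (Fin p) (Fin p) ℝ)
    (v β : EuclideanSpace ℝ (Fin p)) : ℝ :=
  Real.exp (-(((β - v).ofLp ⬝ᵥ (Q *ᵥ (β - v).ofLp)) / 2))

/-- The measure with density likelihood times prior with respect to Lebesgue measure. -/
noncomputable def unnormalizedPosterior {n p : ℕ} (X : Matrix (Fin n) (Fin p) ℝ)
    (Y : Fin n → Bool) (Q : Matrix (Fin p) (Fin p) ℝ) (v : EuclideanSpace ℝ (Fin p)) :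
    Measure (EuclideanSpace ℝ (Fin p)) :=
  volume.withDensity fun β => ENNReal.ofReal (probitLikelihood X Y β * priorDensity Q v β)

/-- The posterior distribution of the regression coefficients. -/
noncomputable def probitPosterior {n p : ℕ} (X : Matrix (Fin n) (Fin p) ℝ)
    (Y : Fin n → Bool) (Q : Matrix (Fin p) (Fin p) ℝ) (v : EuclideanSpace ℝ (Fin p)) :
    Measure (EuclideanSpace ℝ (Fin p)) :=
  (unnormalizedPosterior X Y Q v Set.univ)⁻¹ • unnormalizedPosterior X Y Q v

end Posterior

/-! ### The Albert and Chib data augmentation chain -/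

section Chain

/-- The half line to which a latent variable is truncated: `(0, ∞)` if the response is `1`,
and `(-∞, 0)` if it is `0`. -/
def truncSet (y : Bool) : Set ℝ := if y then Set.Ioi 0 else Set.Iio 0

theorem measurableSet_truncSet (y : Bool) : MeasurableSet (truncSet y) := by
  cases y
  · exact measurableSet_Iio
  · exact measurableSet_Ioi

/-- The truncated normal distribution `TN(θ, 1; y)`. -/
noncomputable def truncNormal (θ : ℝ) (y : Bool) : Measure ℝ :=
  ProbabilityTheory.cond (gaussianReal θ 1) (truncSet y)

theorem gaussianReal_truncSet_ne_zero (θ : ℝ) (y : Bool) :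
    gaussianReal θ 1 (truncSet y) ≠ 0 := by
  intro h
  have h' := gaussianReal_absolutelyContinuous' θ (v := 1) one_ne_zero h
  cases y <;> simp [truncSet] at h'

instance (θ : ℝ) (y : Bool) : IsProbabilityMeasure (truncNormal θ y) :=
  cond_isProbabilityMeasure (gaussianReal_truncSet_ne_zero θ y)

theorem measurable_gaussianReal_mean : Measurable fun θ : ℝ => gaussianReal θ 1 := by
  have h : (fun θ : ℝ => gaussianReal θ 1)
      = fun θ : ℝ => ((gaussianReal 0 1).map (Prod.mk θ)).map (fun q : ℝ × ℝ => q.1 + q.2) := by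
    funext θ
    rw [Measure.map_map (by fun_prop) (by fun_prop)]
    have := gaussianReal_map_const_add (μ := 0) (v := 1) θ
    rw [zero_add] at this
    exact this.symm
  rw [h]
  exact (Measure.measurable_map _ (by fun_prop)).comp Measurable.map_prodMk_left

theorem measurable_truncNormal (y : Bool) : Measurable fun θ : ℝ => truncNormal θ y := by
  refine Measure.measurable_of_measurable_coe _ fun s hs => ?_
  have hm := measurableSet_truncSet y
  simp only [truncNormal, cond_apply hm]
  exact (((Measure.measurable_coe hm).comp measurable_gaussianReal_mean).inv).mul
    ((Measure.measurable_coe (hm.inter hs)).comp measurable_gaussianReal_mean)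

/-- First step of the algorithm: given `β`, draw independently `Z_i ∼ TN(X_iᵀ β, 1; Y_i)`. -/
noncomputable def latentKernel {n p : ℕ} (X : Matrix (Fin n) (Fin p) ℝ) (Y : Fin n → Bool) :
    Kernel (EuclideanSpace ℝ (Fin p)) (Fin n → ℝ) where
  toFun β := Measure.pi fun i => truncNormal ((X *ᵥ β.ofLp) i) (Y i)
  measurable' := by
    refine Measurable.measure_of_isPiSystem_of_isProbabilityMeasure generateFrom_pi.symm
      isPiSystem_pi ?_
    rintro _ ⟨s, hs, rfl⟩
    simp only [Measure.pi_pi]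
    refine Finset.measurable_prod _ fun i _ => ?_
    have hX : Measurable fun β : EuclideanSpace ℝ (Fin p) => (X *ᵥ β.ofLp) i := by
      simp only [Matrix.mulVec, dotProduct]
      fun_prop
    exact (Measure.measurable_coe (show MeasurableSet (s i) from hs i (Set.mem_univ i))).comp
      ((measurable_truncNormal (Y i)).comp hX)

/-- The matrix `Σ = Xᵀ X + Q`. -/
def sigmaMatrix {n p : ℕ} (X : Matrix (Fin n) (Fin p) ℝ) (Q : Matrix (Fin p) (Fin p) ℝ) :
    Matrix (Fin p) (Fin p) ℝ :=
  Xᵀ * X + Q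

/-- The conditional mean `Σ⁻¹ (Xᵀ z + Q v)`. -/
noncomputable def condMean {n p : ℕ} (X : Matrix (Fin n) (Fin p) ℝ)
    (Q : Matrix (Fin p) (Fin p) ℝ) (v : EuclideanSpace ℝ (Fin p)) (z : Fin n → ℝ) :
    EuclideanSpace ℝ (Fin p) :=
  WithLp.toLp 2 ((sigmaMatrix X Q)⁻¹ *ᵥ (Xᵀ *ᵥ z + Q *ᵥ v.ofLp))

theorem measurable_condMean {n p : ℕ} (X : Matrix (Fin n) (Fin p) ℝ)
    (Q : Matrix (Fin p) (Fin p) ℝ) (v : EuclideanSpace ℝ (Fin p)) :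
    Measurable (condMean X Q v) := by
  have : Continuous (condMean X Q v) := by
    unfold condMean
    fun_prop
  exact this.measurable

theorem measurable_multivariateGaussian_mean {p : ℕ} (S : Matrix (Fin p) (Fin p) ℝ) :
    Measurable fun μ : EuclideanSpace ℝ (Fin p) => multivariateGaussian μ S := by
  have h : (fun μ : EuclideanSpace ℝ (Fin p) => multivariateGaussian μ S)
      = fun μ => ((multivariateGaussian 0 S).map (Prod.mk μ)).map
          (fun q : EuclideanSpace ℝ (Fin p) × EuclideanSpace ℝ (Fin p) => q.1 + q.2) := by
    funext μ
    rw [Measure.map_map (by fun_prop) (by fun_prop)]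
    simp only [multivariateGaussian]
    rw [Measure.map_map (by fun_prop) (by fun_prop)]
    congr 1
    funext x
    simp
  rw [h]
  exact (Measure.measurable_map _ (by fun_prop)).comp Measurable.map_prodMk_left

/-- Second step of the algorithm: given `z`, draw from `N_p(Σ⁻¹ (Xᵀ z + Q v), Σ⁻¹)`. -/
noncomputable def coefKernel {n p : ℕ} (X : Matrix (Fin n) (Fin p) ℝ)
    (Q : Matrix (Fin p) (Fin p) ℝ) (v : EuclideanSpace ℝ (Fin p)) :
    Kernel (Fin n → ℝ) (EuclideanSpace ℝ (Fin p)) where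
  toFun z := multivariateGaussian (condMean X Q v z) (sigmaMatrix X Q)⁻¹
  measurable' :=
    (measurable_multivariateGaussian_mean (sigmaMatrix X Q)⁻¹).comp (measurable_condMean X Q v)

/-- The transition function of the Albert and Chib chain: the first step followed by the
second. -/
noncomputable def acKernel {n p : ℕ} (X : Matrix (Fin n) (Fin p) ℝ) (Y : Fin n → Bool)
    (Q : Matrix (Fin p) (Fin p) ℝ) (v : EuclideanSpace ℝ (Fin p)) :
    Kernel (EuclideanSpace ℝ (Fin p)) (EuclideanSpace ℝ (Fin p)) :=
  coefKernel X Q v ∘ₖ latentKernel X Y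

/-- The geometric convergence rate `ρ_*(𝒟)` of the Albert and Chib chain for the prior and data
`𝒟 = (v, Q, X, Y)`. -/
noncomputable def acRate {n p : ℕ} (v : EuclideanSpace ℝ (Fin p)) (Q : Matrix (Fin p) (Fin p) ℝ)
    (X : Matrix (Fin n) (Fin p) ℝ) (Y : Fin n → Bool) : ℝ :=
  geomRate (acKernel X Y Q v) (probitPosterior X Y Q v)

end Chain

/-- The largest eigenvalue of a real symmetric matrix (`0` for the empty matrix). -/
noncomputable def lambdaMax {n : ℕ} (A : Matrix (Fin n) (Fin n) ℝ) : ℝ :=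
  sSup (spectrum ℝ A)

/-! The chain contracts in the seminorm `β ↦ ‖X β‖`, by a factor depending only on `c`; this is
shown by coupling two copies.

Latent step: two normals with unit variance, truncated to the same half line, are coupled through
their quantile functions. The law with the larger location is stochastically larger (monotone
likelihood ratio), but by no more than the shift of location. Hence the quantile functions differ by
at most the difference of locations (`abs_quantileFun_truncNormal_sub_le`), and the latent vectors
are no further apart than the linear predictors.

Coefficient step: both copies use the same Gaussian noise, so only the conditional means differ, by
`Σ⁻¹ Xᵀ (z - z')`. The prior mean cancels. An eigenvalue `λ` of `X Q⁻¹ Xᵀ` becomes the eigenvalue `λ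
/ (1 + λ)` of `X Σ⁻¹ Xᵀ`, which gives the factor `c / (1 + c)` (`norm_linPred_condMean_sub_le`).

To reach total variation, one step is spent on smoothing: Gaussian laws with fixed covariance are
Lipschitz in their mean in total variation, so `β ↦ K(β, s)` is Lipschitz in `X β`, uniformly in
`s`. Each further step multiplies the Lipschitz constant by `c / (1 + c)`. Averaging the second
starting point over the posterior, which is invariant and has a finite first moment, gives
convergence at that rate. The smoothing constant and the moment enter only the prefactor `M`, so
dimension and prior mean do not affect the rate. -/

open scoped MatrixOrder

/-! ### Quantile functions -/

section Quantile

/-- The quantile function of a distribution on the line, extended by zero outside `(0, 1)`. -/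
noncomputable def quantileFun (μ : Measure ℝ) (u : ℝ) : ℝ :=
  open Classical in if u ∈ Set.Ioo (0 : ℝ) 1 then sInf {x | u ≤ cdf μ x} else 0

theorem quantileFun_of_notMem (μ : Measure ℝ) {u : ℝ} (hu : u ∉ Set.Ioo (0 : ℝ) 1) :
    quantileFun μ u = 0 := if_neg hu

theorem quantileFun_le_iff (μ : Measure ℝ) {u : ℝ} (hu : u ∈ Set.Ioo (0 : ℝ) 1) (x : ℝ) :
    quantileFun μ u ≤ x ↔ u ≤ cdf μ x := by
  rw [quantileFun, if_pos hu]
  have hne : {x | u ≤ cdf μ x}.Nonempty :=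
    (((tendsto_cdf_atTop μ).eventually (lt_mem_nhds hu.2)).exists).imp fun _ h => h.le
  have hbdd : BddBelow {x | u ≤ cdf μ x} := by
    obtain ⟨a, ha⟩ := ((tendsto_cdf_atBot μ).eventually (gt_mem_nhds hu.1)).exists
    refine ⟨a, fun y hy => ?_⟩
    by_contra! h
    exact absurd (hy.trans (monotone_cdf μ h.le)) (not_le.2 ha)
  refine ⟨fun h => ?_, fun h => csInf_le hbdd h⟩
  -- Every point to the right of `x` satisfies the defining inequality of the infimum; right
  -- continuity carries it to `x` itself.
  have hlim : Filter.Tendsto (cdf μ) (nhdsWithin x (Set.Ioi x)) (nhds (cdf μ x)) :=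
    ((cdf μ).right_continuous x).mono Set.Ioi_subset_Ici_self
  refine ge_of_tendsto hlim ?_
  filter_upwards [self_mem_nhdsWithin] with y hy
  obtain ⟨s, hs, hsy⟩ := exists_lt_of_csInf_lt hne (lt_of_le_of_lt h hy)
  exact le_trans hs (monotone_cdf μ hsy.le)

theorem measurable_quantileFun (μ : Measure ℝ) : Measurable (quantileFun μ) := by
  refine measurable_of_Iic fun x => ?_
  have : quantileFun μ ⁻¹' Set.Iic x = (Set.Ioo 0 1 ∩ Set.Iic (cdf μ x)) ∪
      ((Set.Ioo (0 : ℝ) 1)ᶜ ∩ {_u | 0 ≤ x}) := by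
    ext u
    by_cases hu : u ∈ Set.Ioo (0 : ℝ) 1
    · simp [quantileFun_le_iff μ hu, hu]
    · simp [quantileFun_of_notMem μ hu, hu]
  rw [this]
  exact (measurableSet_Ioo.inter measurableSet_Iic).union
    (measurableSet_Ioo.compl.inter (MeasurableSet.const _))

/-- The uniform distribution on `(0, 1)`. -/
noncomputable def uniformUnit : Measure ℝ := volume.restrict (Set.Ioo 0 1)

instance : IsProbabilityMeasure uniformUnit := ⟨by simp [uniformUnit]⟩

/-- Inverse transform sampling: all laws on the line become functions of one uniform variable, and
sharing that variable couples them. -/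
theorem map_quantileFun (μ : Measure ℝ) [IsProbabilityMeasure μ] :
    uniformUnit.map (quantileFun μ) = μ := by
  have := Measure.isProbabilityMeasure_map (μ := uniformUnit) (measurable_quantileFun μ).aemeasurable
  refine Measure.ext_of_Iic _ _ fun x => ?_
  rw [Measure.map_apply (measurable_quantileFun μ) measurableSet_Iic, uniformUnit,
    Measure.restrict_apply (measurable_quantileFun μ measurableSet_Iic)]
  have hset : quantileFun μ ⁻¹' Set.Iic x ∩ Set.Ioo 0 1 = Set.Iic (cdf μ x) ∩ Set.Ioo 0 1 := by
    ext u
    simp only [Set.mem_inter_iff, Set.mem_preimage, Set.mem_Iic, and_congr_left_iff]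
    exact fun hu => quantileFun_le_iff μ hu x
  rw [hset, ← ofReal_cdf]
  rcases (cdf_le_one μ x).lt_or_eq with h | h
  · have : Set.Iic (cdf μ x) ∩ Set.Ioo 0 1 = Set.Ioc 0 (cdf μ x) := by
      ext u
      simp only [Set.mem_inter_iff, Set.mem_Iic, Set.mem_Ioo, Set.mem_Ioc]
      constructor
      · rintro ⟨h1, h2, h3⟩
        exact ⟨h2, h1⟩
      · rintro ⟨h1, h2⟩
        exact ⟨h2, h1, h2.trans_lt h⟩
    rw [this, Real.volume_Ioc, sub_zero]
  · have : Set.Iic (cdf μ x) ∩ Set.Ioo 0 1 = Set.Ioo 0 1 := by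
      rw [h]
      exact Set.inter_eq_right.2 fun u hu => hu.2.le
    rw [this, h, Real.volume_Ioo, sub_zero]

/-- If `ν` lies between `μ` and the translate of `μ` by `δ` in the stochastic order, then so do
the quantile functions. -/
theorem abs_quantileFun_sub_le {μ ν : Measure ℝ} {δ : ℝ} (hδ : 0 ≤ δ)
    (h₁ : ∀ x, cdf ν x ≤ cdf μ x) (h₂ : ∀ x, cdf μ (x - δ) ≤ cdf ν x) (u : ℝ) :
    |quantileFun ν u - quantileFun μ u| ≤ δ := by
  by_cases hu : u ∈ Set.Ioo (0 : ℝ) 1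
  · have h3 : quantileFun μ u ≤ quantileFun ν u :=
      (quantileFun_le_iff μ hu _).2 (((quantileFun_le_iff ν hu _).1 le_rfl).trans (h₁ _))
    have h4 : quantileFun ν u ≤ quantileFun μ u + δ := by
      refine (quantileFun_le_iff ν hu _).2 (le_trans ?_ (h₂ _))
      rw [add_sub_cancel_right]
      exact (quantileFun_le_iff μ hu _).1 le_rfl
    rw [abs_le]
    constructor <;> linarith
  · simpa [quantileFun_of_notMem _ hu] using hδ

end Quantile

/-! ### Coupling of truncated normal distributions -/

section TruncNormal

/-- Intended for `S` below and `T` above a cut point, with `r` the value at the cut of an increasing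
likelihood ratio of `ν` to `μ`. -/
theorem measure_mul_le_of_density_cross {μ ν : Measure ℝ} {r : ENNReal} {S T : Set ℝ}
    (hS : ν S ≤ r * μ S) (hT : r * μ T ≤ ν T) : ν S * μ T ≤ μ S * ν T :=
  calc ν S * μ T ≤ r * μ S * μ T := by gcongr
    _ = μ S * (r * μ T) := by ring
    _ ≤ μ S * ν T := by gcongr

/-- Comparing odds is enough: clearing the normalizing constants and splitting along `s` and `t`,
the product `μ (S ∩ s) * ν (T ∩ t)` appears on both sides and cancels. -/
theorem cond_le_cond {μ ν : Measure ℝ} [IsFiniteMeasure μ] [IsFiniteMeasure ν] {S T s t : Set ℝ}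
    (hS : MeasurableSet S) (hT : MeasurableSet T) (hs : MeasurableSet s) (ht : MeasurableSet t)
    (hμ : μ S ≠ 0) (hν : ν T ≠ 0) (h : μ (S ∩ s) * ν (T ∩ tᶜ) ≤ ν (T ∩ t) * μ (S ∩ sᶜ)) :
    (cond μ S) s ≤ (cond ν T) t := by
  rw [cond_apply hS, cond_apply hT, mul_comm, ← div_eq_mul_inv, mul_comm, ← div_eq_mul_inv,
    ENNReal.div_le_iff hμ (measure_ne_top _ _), ENNReal.div_eq_inv_mul, mul_assoc,
    ← ENNReal.div_eq_inv_mul, ENNReal.le_div_iff_mul_le (.inl hν) (.inl (measure_ne_top _ _))]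
  calc μ (S ∩ s) * ν T = μ (S ∩ s) * ν (T ∩ t) + μ (S ∩ s) * ν (T ∩ tᶜ) := by
        rw [← mul_add, ← Set.sdiff_eq, measure_inter_add_sdiff _ ht]
    _ ≤ μ (S ∩ s) * ν (T ∩ t) + ν (T ∩ t) * μ (S ∩ sᶜ) := by gcongr
    _ = ν (T ∩ t) * (μ (S ∩ s) + μ (S ∩ sᶜ)) := by ring
    _ = ν (T ∩ t) * μ S := by rw [← Set.sdiff_eq, measure_inter_add_sdiff _ hs]

theorem gaussianPDF_eq_tilt (θ θ' x : ℝ) :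
    gaussianPDF θ' 1 x =
      ENNReal.ofReal (Real.exp ((θ' - θ) * x - (θ' ^ 2 - θ ^ 2) / 2)) * gaussianPDF θ 1 x := by
  rw [gaussianPDF, gaussianPDF, ← ENNReal.ofReal_mul (Real.exp_nonneg _), gaussianPDFReal,
    gaussianPDFReal, mul_left_comm, ← Real.exp_add]
  congr 3
  simp only [NNReal.coe_one]
  ring_nf

/-- Monotone likelihood ratio: the tilt from `θ` to `θ'` increases in `x`, so its value at `a`
separates the two sets. -/
theorem gaussianReal_cross_le {θ θ' : ℝ} (h : θ ≤ θ') (a : ℝ) {S T : Set ℝ}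
    (hS : MeasurableSet S) (hT : MeasurableSet T) (hSa : S ⊆ Set.Iic a) (hTa : T ⊆ Set.Ioi a) :
    gaussianReal θ' 1 S * gaussianReal θ 1 T ≤ gaussianReal θ 1 S * gaussianReal θ' 1 T := by
  refine measure_mul_le_of_density_cross
    (r := ENNReal.ofReal (Real.exp ((θ' - θ) * a - (θ' ^ 2 - θ ^ 2) / 2))) ?_ ?_
  · rw [gaussianReal_apply _ one_ne_zero, gaussianReal_apply _ one_ne_zero,
      ← lintegral_const_mul _ (measurable_gaussianPDF _ _)]
    refine setLIntegral_mono' hS fun x hx => ?_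
    rw [gaussianPDF_eq_tilt θ θ']
    have := mul_le_mul_of_nonneg_left (hSa hx) (sub_nonneg.2 h)
    gcongr
  · rw [gaussianReal_apply _ one_ne_zero, gaussianReal_apply _ one_ne_zero,
      ← lintegral_const_mul _ (measurable_gaussianPDF _ _)]
    refine setLIntegral_mono' hT fun x hx => ?_
    rw [gaussianPDF_eq_tilt θ θ']
    have := mul_le_mul_of_nonneg_left (le_of_lt (hTa hx)) (sub_nonneg.2 h)
    gcongr

theorem truncNormal_Iic_le_of_le {θ θ' : ℝ} (h : θ ≤ θ') (y : Bool) (x : ℝ) :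
    truncNormal θ' y (Set.Iic x) ≤ truncNormal θ y (Set.Iic x) := by
  have hm := measurableSet_truncSet y
  refine cond_le_cond hm hm measurableSet_Iic measurableSet_Iic (gaussianReal_truncSet_ne_zero _ _)
    (gaussianReal_truncSet_ne_zero _ _) ?_
  exact gaussianReal_cross_le h x (hm.inter measurableSet_Iic) (hm.inter measurableSet_Iic.compl)
    Set.inter_subset_right (by rw [Set.compl_Iic]; exact Set.inter_subset_right)

/-- Translation by `δ = θ' - θ` turns the law at `θ` into `N(θ', 1)` conditioned on the half line
moved right by `δ`. Moving the half line to the right can only make the conditional law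
stochastically larger. -/
theorem truncNormal_Iic_sub_le {θ θ' : ℝ} (h : θ ≤ θ') (y : Bool) (x : ℝ) :
    truncNormal θ y (Set.Iic (x - (θ' - θ))) ≤ truncNormal θ' y (Set.Iic x) := by
  have hm := measurableSet_truncSet y
  have key : ∀ s : Set ℝ, MeasurableSet s →
      gaussianReal θ 1 s = gaussianReal θ' 1 ((fun z => z - (θ' - θ)) ⁻¹' s) := by
    intro s hs
    rw [← Measure.map_apply (by fun_prop) hs, gaussianReal_map_sub_const]
    congr 2
    ring
  refine cond_le_cond hm hm measurableSet_Iic measurableSet_Iic (gaussianReal_truncSet_ne_zero _ _)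
    (gaussianReal_truncSet_ne_zero _ _) ?_
  rw [key _ (hm.inter measurableSet_Iic), key _ (hm.inter measurableSet_Iic.compl)]
  have hδ : 0 ≤ θ' - θ := sub_nonneg.2 h
  generalize θ' - θ = δ at hδ
  -- In each case one range of `x` makes a factor on the left vanish; otherwise the factors compare
  -- by inclusion of sets.
  rcases y
  · rcases le_or_gt 0 x with hx | hx
    · have : truncSet false ∩ (Set.Iic x)ᶜ = ∅ := by
        ext z
        simp only [truncSet, Set.mem_inter_iff, Set.mem_compl_iff, Set.mem_Iic, not_le,
          Set.mem_empty_iff_false, iff_false, not_and, Bool.false_eq_true, if_false, Set.mem_Iio]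
        intro hz
        linarith
      rw [this, measure_empty, mul_zero]
      exact zero_le
    · refine mul_le_mul' (measure_mono fun z hz => ?_) (measure_mono fun z hz => ?_)
      · simp only [truncSet, Bool.false_eq_true, if_false, Set.mem_preimage, Set.mem_inter_iff,
          Set.mem_Iio, Set.mem_Iic] at hz ⊢
        constructor <;> linarith [hz.1, hz.2]
      · simp only [truncSet, Bool.false_eq_true, if_false, Set.mem_preimage, Set.mem_inter_iff,
          Set.mem_Iio, Set.mem_Iic, Set.mem_compl_iff, not_le] at hz ⊢
        constructor <;> linarith [hz.1, hz.2]
  · rcases le_or_gt x δ with hx | hx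
    · have : (fun z => z - δ) ⁻¹' (truncSet true ∩ Set.Iic (x - δ)) = ∅ := by
        ext z
        simp only [truncSet, Set.mem_inter_iff, Set.mem_preimage, Set.mem_Iic,
          Set.mem_empty_iff_false, iff_false, not_and, if_true, Set.mem_Ioi]
        intro hz
        linarith
      rw [this, measure_empty, zero_mul]
      exact zero_le
    · refine mul_le_mul' (measure_mono fun z hz => ?_) (measure_mono fun z hz => ?_)
      · simp only [truncSet, if_true, Set.mem_preimage, Set.mem_inter_iff,
          Set.mem_Ioi, Set.mem_Iic] at hz ⊢
        constructor <;> linarith [hz.1, hz.2]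
      · simp only [truncSet, if_true, Set.mem_preimage, Set.mem_inter_iff,
          Set.mem_Ioi, Set.mem_Iic, Set.mem_compl_iff, not_le] at hz ⊢
        constructor <;> linarith [hz.1, hz.2]

/-- The quantile coupling of truncated normal distributions is a contraction in the location. -/
theorem abs_quantileFun_truncNormal_sub_le (θ θ' : ℝ) (y : Bool) (u : ℝ) :
    |quantileFun (truncNormal θ y) u - quantileFun (truncNormal θ' y) u| ≤ |θ - θ'| := by
  wlog h : θ' ≤ θ generalizing θ θ'
  · rw [abs_sub_comm, abs_sub_comm θ]
    exact this θ' θ (le_of_not_ge h)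
  rw [abs_of_nonneg (sub_nonneg.2 h)]
  refine abs_quantileFun_sub_le (sub_nonneg.2 h) (fun x => ?_) (fun x => ?_) u
  · rw [cdf_eq_real, cdf_eq_real]
    exact ENNReal.toReal_mono (measure_ne_top _ _) (truncNormal_Iic_le_of_le h y x)
  · rw [cdf_eq_real, cdf_eq_real]
    exact ENNReal.toReal_mono (measure_ne_top _ _) (truncNormal_Iic_sub_le h y x)

end TruncNormal

/-! ### Contraction properties of the two steps -/

section Contraction

variable {n p : ℕ}

/-- The vector `X β` of linear predictors. -/
noncomputable def linPred (X : Matrix (Fin n) (Fin p) ℝ) (β : EuclideanSpace ℝ (Fin p)) :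
    EuclideanSpace ℝ (Fin n) :=
  WithLp.toLp 2 (X *ᵥ β.ofLp)

theorem continuous_linPred (X : Matrix (Fin n) (Fin p) ℝ) : Continuous (linPred X) := by
  unfold linPred
  fun_prop

theorem norm_toLp_le_of_abs_le {x y : Fin n → ℝ} (h : ∀ i, |x i| ≤ |y i|) :
    ‖WithLp.toLp 2 x‖ ≤ ‖WithLp.toLp 2 y‖ := by
  rw [EuclideanSpace.norm_eq, EuclideanSpace.norm_eq]
  refine Real.sqrt_le_sqrt (Finset.sum_le_sum fun i _ => ?_)
  simpa [sq_abs] using pow_le_pow_left₀ (abs_nonneg _) (h i) 2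

/-- The uniforms do not depend on `β`, so this realizes the latent vectors for all `β` on one
probability space. -/
theorem latentKernel_eq_map (X : Matrix (Fin n) (Fin p) ℝ) (Y : Fin n → Bool)
    (β : EuclideanSpace ℝ (Fin p)) :
    latentKernel X Y β = (Measure.pi fun _ : Fin n => uniformUnit).map
      fun u i => quantileFun (truncNormal ((X *ᵥ β.ofLp) i) (Y i)) (u i) := by
  have hp : ∀ i, IsProbabilityMeasure
      (uniformUnit.map (quantileFun (truncNormal ((X *ᵥ β.ofLp) i) (Y i)))) := fun i =>
    Measure.isProbabilityMeasure_map (measurable_quantileFun _).aemeasurable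
  have h := Measure.pi_map_pi (μ := fun _ : Fin n => uniformUnit)
    (f := fun i => quantileFun (truncNormal ((X *ᵥ β.ofLp) i) (Y i)))
    fun i => (measurable_quantileFun _).aemeasurable
  rw [h]
  simp only [map_quantileFun]
  rfl

instance (X : Matrix (Fin n) (Fin p) ℝ) (Y : Fin n → Bool) : IsMarkovKernel (latentKernel X Y) :=
  ⟨fun β => inferInstanceAs (IsProbabilityMeasure
    (Measure.pi fun i => truncNormal ((X *ᵥ β.ofLp) i) (Y i)))⟩

/-- The first step maps bounded Lipschitz functions of the latent variables to functions of the
linear predictors with the same Lipschitz constant. -/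
theorem abs_integral_latentKernel_sub_le (X : Matrix (Fin n) (Fin p) ℝ) (Y : Fin n → Bool)
    {h : (Fin n → ℝ) → ℝ} (hm : Measurable h) {C L : ℝ} (hL : 0 ≤ L) (hC : ∀ z, |h z| ≤ C)
    (hLip : ∀ z z', |h z - h z'| ≤ L * ‖WithLp.toLp 2 (z - z')‖)
    (β β' : EuclideanSpace ℝ (Fin p)) :
    |∫ z, h z ∂latentKernel X Y β - ∫ z, h z ∂latentKernel X Y β'|
      ≤ L * ‖linPred X β - linPred X β'‖ := by
  have hq : ∀ β : EuclideanSpace ℝ (Fin p), Measurable fun (u : Fin n → ℝ) i =>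
      quantileFun (truncNormal ((X *ᵥ β.ofLp) i) (Y i)) (u i) := fun β =>
    measurable_pi_lambda _ fun i => (measurable_quantileFun _).comp (measurable_pi_apply i)
  have hi : ∀ β : EuclideanSpace ℝ (Fin p), Integrable (fun u : Fin n → ℝ =>
      h fun i => quantileFun (truncNormal ((X *ᵥ β.ofLp) i) (Y i)) (u i))
      (Measure.pi fun _ : Fin n => uniformUnit) := fun β =>
    Integrable.of_bound (hm.comp (hq β)).aestronglyMeasurable C
      (Filter.Eventually.of_forall fun u => hC _)
  rw [latentKernel_eq_map, latentKernel_eq_map,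
    integral_map (hq β).aemeasurable hm.aestronglyMeasurable,
    integral_map (hq β').aemeasurable hm.aestronglyMeasurable, ← integral_sub (hi β) (hi β'),
    ← Real.norm_eq_abs]
  refine (norm_integral_le_of_norm_le_const (Filter.Eventually.of_forall fun u => ?_)).trans_eq
    (by rw [probReal_univ, mul_one])
  rw [Real.norm_eq_abs]
  refine (hLip _ _).trans (mul_le_mul_of_nonneg_left ?_ hL)
  exact norm_toLp_le_of_abs_le fun i => abs_quantileFun_truncNormal_sub_le _ _ _ _

theorem sigmaMatrix_posDef (X : Matrix (Fin n) (Fin p) ℝ) {Q : Matrix (Fin p) (Fin p) ℝ}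
    (hQ : Q.PosDef) : (sigmaMatrix X Q).PosDef := by
  simpa [sigmaMatrix] using
    PosDef.posSemidef_add (Matrix.posSemidef_conjTranspose_mul_self X) hQ

/-- The eigenvalues of `c • 1 - A` are `c` minus those of `A`, hence nonnegative. Finiteness of the
spectrum makes the supremum a genuine upper bound. -/
theorem dotProduct_mulVec_le_of_lambdaMax_lt {A : Matrix (Fin n) (Fin n) ℝ} (hA : A.IsHermitian)
    {c : ℝ} (hc : lambdaMax A < c) (y : Fin n → ℝ) : y ⬝ᵥ (A *ᵥ y) ≤ c * (y ⬝ᵥ y) := by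
  have hps : (c • (1 : Matrix (Fin n) (Fin n) ℝ) - A).PosSemidef := by
    have hM : (c • (1 : Matrix (Fin n) (Fin n) ℝ) - A).IsHermitian := by
      refine IsHermitian.sub ?_ hA
      simp [IsHermitian]
    refine hM.posSemidef_iff_eigenvalues_nonneg.2 fun i => ?_
    have h1 : hM.eigenvalues i ∈
        spectrum ℝ (algebraMap ℝ (Matrix (Fin n) (Fin n) ℝ) c - A) := by
      simpa only [Algebra.algebraMap_eq_smul_one] using hM.eigenvalues_mem_spectrum_real i
    rw [← spectrum.singleton_sub_eq] at h1
    obtain ⟨r, hr, x, hx, hrx⟩ := h1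
    rw [Set.mem_singleton_iff] at hr
    have h2 : x ≤ lambdaMax A := le_csSup A.finite_real_spectrum.bddAbove hx
    simp only [Pi.zero_apply]
    simp only at hrx
    linarith
  have := hps.dotProduct_mulVec_nonneg y
  simp only [star_trivial, Matrix.sub_mulVec, Matrix.smul_mulVec, Matrix.one_mulVec,
    dotProduct_sub, dotProduct_smul, smul_eq_mul] at this
  linarith

/-- The linear predictors at the conditional means contract. -/
theorem norm_linPred_condMean_sub_le (X : Matrix (Fin n) (Fin p) ℝ)
    {Q : Matrix (Fin p) (Fin p) ℝ} (hQ : Q.PosDef) {c : ℝ} (hc : 0 < c)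
    (hX : lambdaMax (X * Q⁻¹ * Xᵀ) < c) (v : EuclideanSpace ℝ (Fin p)) (z z' : Fin n → ℝ) :
    ‖linPred X (condMean X Q v z) - linPred X (condMean X Q v z')‖
      ≤ c / (1 + c) * ‖WithLp.toLp 2 (z - z')‖ := by
  have hunit := (sigmaMatrix_posDef X hQ).isUnit
  have hQt : Qᵀ = Q := by simpa using hQ.isHermitian.eq
  set d := z - z'
  set t := (sigmaMatrix X Q)⁻¹ *ᵥ (Xᵀ *ᵥ d) with ht
  set y := X *ᵥ t
  -- The prior mean enters additively and drops out here.
  have hdiff : linPred X (condMean X Q v z) - linPred X (condMean X Q v z') = WithLp.toLp 2 y := by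
    rw [linPred, linPred, ← WithLp.toLp_sub, condMean, condMean, ← mulVec_sub, ← mulVec_sub,
      add_sub_add_right_eq_sub, ← mulVec_sub]
  have hsys : Xᵀ *ᵥ y + Q *ᵥ t = Xᵀ *ᵥ d := by
    have : sigmaMatrix X Q *ᵥ t = Xᵀ *ᵥ d := by
      rw [ht, mulVec_mulVec, mul_nonsing_inv _ ((isUnit_iff_isUnit_det _).1 hunit), one_mulVec]
    rw [← this, sigmaMatrix, add_mulVec, ← mulVec_mulVec]
  have hadj : ∀ (a : Fin p → ℝ) (b : Fin n → ℝ), a ⬝ᵥ (Xᵀ *ᵥ b) = (X *ᵥ a) ⬝ᵥ b := fun a b => by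
    rw [dotProduct_mulVec, vecMul_transpose]
  -- Pair the normal equations `hsys` with `t`.
  have henergy : y ⬝ᵥ y + t ⬝ᵥ (Q *ᵥ t) = y ⬝ᵥ d := by
    rw [← hadj t d, ← hsys, dotProduct_add, hadj]
  -- Cauchy–Schwarz in the `Q` inner product, in the form that the square of `c • t - s` is
  -- nonnegative, where `s` represents `y ⬝ᵥ X ·` in that inner product.
  have hdom : y ⬝ᵥ y ≤ c * (t ⬝ᵥ (Q *ᵥ t)) := by
    set s := Q⁻¹ *ᵥ (Xᵀ *ᵥ y) with hs
    have hQs : Q *ᵥ s = Xᵀ *ᵥ y := by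
      rw [hs, mulVec_mulVec, mul_nonsing_inv _ ((isUnit_iff_isUnit_det _).1 hQ.isUnit), one_mulVec]
    have hss : s ⬝ᵥ (Q *ᵥ s) ≤ c * (y ⬝ᵥ y) := by
      have hA : (X * Q⁻¹ * Xᵀ).IsHermitian := by
        have := isHermitian_mul_mul_conjTranspose X hQ.inv.isHermitian
        simpa using this
      have := dotProduct_mulVec_le_of_lambdaMax_lt hA hX y
      rw [← mulVec_mulVec, ← mulVec_mulVec, ← hs, dotProduct_comm, ← hadj] at this
      rwa [hQs]
    have hts : t ⬝ᵥ (Q *ᵥ s) = y ⬝ᵥ y := by rw [hQs, hadj]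
    have hst : s ⬝ᵥ (Q *ᵥ t) = y ⬝ᵥ y := by
      rw [dotProduct_mulVec, ← hQt, vecMul_transpose, dotProduct_comm, hts]
    have hpos := hQ.posSemidef.dotProduct_mulVec_nonneg (c • t - s)
    simp only [star_trivial, mulVec_sub, mulVec_smul, sub_dotProduct, dotProduct_sub,
      smul_dotProduct, dotProduct_smul, smul_eq_mul, hts, hst] at hpos
    have : 0 ≤ c * (c * (t ⬝ᵥ (Q *ᵥ t)) - y ⬝ᵥ y) := by nlinarith
    linarith [nonneg_of_mul_nonneg_right this hc]
  have hyy : y ⬝ᵥ y = ‖WithLp.toLp 2 y‖ ^ 2 := by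
    rw [EuclideanSpace.real_norm_sq_eq]
    simp [dotProduct, sq]
  have hyd : y ⬝ᵥ d ≤ ‖WithLp.toLp 2 y‖ * ‖WithLp.toLp 2 d‖ := by
    have := real_inner_le_norm (WithLp.toLp 2 d) (WithLp.toLp 2 y)
    rw [EuclideanSpace.inner_toLp_toLp, star_trivial, mul_comm] at this
    exact this
  rw [hdiff]
  rcases (norm_nonneg (WithLp.toLp 2 y)).eq_or_lt' with h0 | h0
  · rw [h0]
    positivity
  -- `henergy` and `hdom` combine to `(1 + c) ‖y‖² ≤ c (y ⬝ᵥ d)`; Cauchy–Schwarz and division by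
  -- `‖y‖` finish.
  rw [div_mul_eq_mul_div, le_div_iff₀ (by linarith)]
  refine le_of_mul_le_mul_left ?_ h0
  nlinarith

end Contraction

/-! ### Densities of Gaussian measures -/

section GaussianDensity

variable {n p : ℕ}

theorem lintegral_pi_prod {μ : Fin n → Measure ℝ} [∀ i, SigmaFinite (μ i)]
    {f : Fin n → ℝ → ENNReal} (hf : ∀ i, Measurable (f i)) :
    ∫⁻ z, ∏ i, f i (z i) ∂Measure.pi μ = ∏ i, ∫⁻ x, f i x ∂μ i := by
  induction n with
  | zero => simp
  | succ n ih =>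
    rw [← (measurePreserving_piFinSuccAbove μ 0).symm.lintegral_comp_emb
      (MeasurableEquiv.measurableEmbedding _), Fin.prod_univ_succ]
    simp only [MeasurableEquiv.piFinSuccAbove_symm_apply, Fin.insertNthEquiv_zero,
      Fin.consEquiv_apply, Fin.prod_univ_succ, Fin.cons_zero, Fin.cons_succ]
    have hm : Measurable fun z : Fin n → ℝ => ∏ i : Fin n, f i.succ (z i) :=
      Finset.measurable_prod _ fun i _ => (hf i.succ).comp (measurable_pi_apply i)
    rw [lintegral_prod_mul (hf 0).aemeasurable hm.aemeasurable]
    congr 1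
    exact ih fun i => hf i.succ

theorem pi_withDensity {f : Fin n → ℝ → ENNReal} (hf : ∀ i, Measurable (f i))
    (hsf : ∀ i, SigmaFinite ((volume : Measure ℝ).withDensity (f i))) :
    Measure.pi (fun i => (volume : Measure ℝ).withDensity (f i))
      = (volume : Measure (Fin n → ℝ)).withDensity fun z => ∏ i, f i (z i) := by
  refine Measure.pi_eq fun s hs => ?_
  rw [withDensity_apply _ (MeasurableSet.univ_pi hs), ← lintegral_indicator (MeasurableSet.univ_pi hs)]
  have : (Set.univ.pi s).indicator (fun z : Fin n → ℝ => ∏ i, f i (z i))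
      = fun z => ∏ i, (s i).indicator (f i) (z i) := by
    funext z
    by_cases hz : z ∈ Set.univ.pi s
    · rw [Set.indicator_of_mem hz]
      exact Finset.prod_congr rfl fun i _ => (Set.indicator_of_mem (hz i (Set.mem_univ i)) _).symm
    · rw [Set.indicator_of_notMem hz]
      simp only [Set.mem_pi, Set.mem_univ, true_imp_iff, not_forall] at hz
      obtain ⟨i, hi⟩ := hz
      exact (Finset.prod_eq_zero (Finset.mem_univ i) (Set.indicator_of_notMem hi _)).symm
  rw [this, volume_pi, lintegral_pi_prod fun i => (hf i).indicator (hs i)]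
  refine Finset.prod_congr rfl fun i _ => ?_
  rw [lintegral_indicator (hs i), withDensity_apply _ (hs i)]

theorem map_withDensity_comp {S T : Type*} [MeasurableSpace S] [MeasurableSpace T] {μ : Measure S}
    {φ : S → T} (hφ : Measurable φ) {g : T → ENNReal} (hg : Measurable g) :
    (μ.withDensity (g ∘ φ)).map φ = (μ.map φ).withDensity g := by
  ext s hs
  rw [Measure.map_apply hφ hs, withDensity_apply _ (hφ hs), withDensity_apply _ hs,
    setLIntegral_map hs hg hφ]
  rfl

theorem stdGaussian_eq_withDensity :
    ∃ κ : ENNReal, stdGaussian (EuclideanSpace ℝ (Fin p)) =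
      κ • volume.withDensity fun x => ENNReal.ofReal (Real.exp (-‖x‖ ^ 2 / 2)) := by
  refine ⟨ENNReal.ofReal (∏ _i : Fin p, (√(2 * Real.pi * (1 : NNReal)))⁻¹), ?_⟩
  rw [← map_pi_eq_stdGaussian]
  have h1 : (fun _ : Fin p => gaussianReal 0 1)
      = fun _ : Fin p => (volume : Measure ℝ).withDensity (gaussianPDF 0 1) := by
    funext i
    rw [gaussianReal_of_var_ne_zero _ one_ne_zero]
  have hsf : SigmaFinite ((volume : Measure ℝ).withDensity (gaussianPDF 0 1)) := by
    rw [← gaussianReal_of_var_ne_zero _ one_ne_zero]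
    infer_instance
  rw [h1, pi_withDensity (fun _ => measurable_gaussianPDF _ _) fun _ => hsf,
    ← withDensity_smul _ (by fun_prop), ← (PiLp.volume_preserving_toLp (Fin p)).map_eq,
    ← map_withDensity_comp (by fun_prop) (by fun_prop)]
  congr 2
  funext z
  simp only [gaussianPDF, Function.comp_apply, Pi.smul_apply, smul_eq_mul]
  rw [← ENNReal.ofReal_prod_of_nonneg fun i _ => gaussianPDFReal_nonneg _ _ _,
    ← ENNReal.ofReal_mul (Finset.prod_nonneg fun i _ => by positivity)]
  simp only [gaussianPDFReal]
  rw [Finset.prod_mul_distrib, ← Real.exp_sum, EuclideanSpace.real_norm_sq_eq]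
  simp [Finset.sum_div, Finset.sum_neg_distrib, neg_div]

theorem continuous_priorDensity (A : Matrix (Fin p) (Fin p) ℝ) (m : EuclideanSpace ℝ (Fin p)) :
    Continuous (priorDensity A m) := by
  unfold priorDensity
  fun_prop

theorem priorDensity_pos (A : Matrix (Fin p) (Fin p) ℝ) (m β : EuclideanSpace ℝ (Fin p)) :
    0 < priorDensity A m β := Real.exp_pos _

/-- The constant is chosen before `m`: one normalization serves all means, because Lebesgue measure
is translation invariant. Its value is never needed, as total mass one determines it. -/
theorem multivariateGaussian_inv_eq_withDensity {A : Matrix (Fin p) (Fin p) ℝ} (hA : A.PosDef) :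
    ∃ κ : ENNReal, ∀ m, multivariateGaussian m A⁻¹ =
      κ • volume.withDensity fun β => ENNReal.ofReal (priorDensity A m β) := by
  obtain ⟨κ, hκ⟩ := stdGaussian_eq_withDensity (p := p)
  set R := CFC.sqrt A⁻¹
  have hRR : R * R = A⁻¹ := CFC.sqrt_mul_sqrt_self _ (Matrix.nonneg_iff_posSemidef.2 hA.inv.posSemidef)
  have hRt : Rᵀ = R := by
    have := (CFC.sqrt_nonneg A⁻¹).isSelfAdjoint
    simpa [IsSelfAdjoint, star_eq_conjTranspose] using this
  have hAu := (isUnit_iff_isUnit_det _).1 hA.isUnit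
  have hRdet : IsUnit R.det := by
    have h : IsUnit (R * R).det := by
      rw [hRR]
      exact isUnit_nonsing_inv_det A hAu
    rw [det_mul] at h
    exact isUnit_of_mul_isUnit_left h
  -- This turns the quadratic form of `A` at `R x` into `‖x‖²`.
  have hRAR : R * A * R = 1 := by
    have h : R * A * R * R = R := by
      rw [mul_assoc, hRR, mul_assoc, mul_nonsing_inv _ hAu, mul_one]
    calc R * A * R = R * A * R * R * R⁻¹ := by
          rw [mul_nonsing_inv_cancel_right _ _ hRdet]
      _ = 1 := by rw [h, mul_nonsing_inv _ hRdet]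
  have hdet : LinearMap.det (toEuclideanCLM (𝕜 := ℝ) R : EuclideanSpace ℝ (Fin p) →ₗ[ℝ] _) ≠ 0 := by
    rw [coe_toEuclideanCLM_eq_toEuclideanLin, toEuclideanLin, LinearMap.det_toLpLin]
    exact hRdet.ne_zero
  refine ⟨κ * ENNReal.ofReal |(LinearMap.det
    (toEuclideanCLM (𝕜 := ℝ) R : EuclideanSpace ℝ (Fin p) →ₗ[ℝ] _))⁻¹|, fun m => ?_⟩
  have hvol : (volume : Measure (EuclideanSpace ℝ (Fin p))).map
      (fun x => m + toEuclideanCLM (𝕜 := ℝ) R x) = ENNReal.ofReal |(LinearMap.det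
    (toEuclideanCLM (𝕜 := ℝ) R : EuclideanSpace ℝ (Fin p) →ₗ[ℝ] _))⁻¹| • volume := by
    have h1 := Measure.map_linearMap_addHaar_eq_smul_addHaar
      (volume : Measure (EuclideanSpace ℝ (Fin p))) hdet
    have h2 : (fun x => m + toEuclideanCLM (𝕜 := ℝ) R x) = (fun x => m + x) ∘
      (toEuclideanCLM (𝕜 := ℝ) R : EuclideanSpace ℝ (Fin p) →ₗ[ℝ] EuclideanSpace ℝ (Fin p)) := rfl
    rw [h2, ← Measure.map_map (measurable_const_add m)
      (LinearMap.continuous_of_finiteDimensional _).measurable, h1,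
      Measure.map_smul, map_add_left_eq_self]
  have hg : (fun x : EuclideanSpace ℝ (Fin p) => ENNReal.ofReal (Real.exp (-‖x‖ ^ 2 / 2)))
      = (fun β => ENNReal.ofReal (priorDensity A m β)) ∘
        fun x => m + toEuclideanCLM (𝕜 := ℝ) R x := by
    funext x
    simp only [Function.comp_apply, priorDensity, add_sub_cancel_left]
    have h3 : (toEuclideanCLM (𝕜 := ℝ) R x).ofLp = R *ᵥ x.ofLp := by
      simp
    rw [h3, neg_div, EuclideanSpace.real_norm_sq_eq]
    congr 4
    have h4 : (R *ᵥ x.ofLp) ⬝ᵥ (A *ᵥ (R *ᵥ x.ofLp)) = x.ofLp ⬝ᵥ x.ofLp := by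
      conv_lhs => rw [dotProduct_comm]
      rw [dotProduct_mulVec, ← hRt, vecMul_transpose, hRt, mulVec_mulVec, mulVec_mulVec, hRAR,
        one_mulVec]
    rw [h4]
    simp [dotProduct, sq]
  rw [multivariateGaussian, hκ, Measure.map_smul, hg,
    map_withDensity_comp (by fun_prop) (continuous_priorDensity A m).measurable.ennreal_ofReal, hvol,
    withDensity_smul_measure, smul_smul]

theorem lintegral_priorDensity_of_eq_withDensity {A : Matrix (Fin p) (Fin p) ℝ} {κ : ENNReal}
    (hκ : ∀ m, multivariateGaussian m A⁻¹ =
      κ • volume.withDensity fun β => ENNReal.ofReal (priorDensity A m β))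
    (m : EuclideanSpace ℝ (Fin p)) :
    κ * ∫⁻ β, ENNReal.ofReal (priorDensity A m β) = 1 := by
  have h : multivariateGaussian m A⁻¹ Set.univ = 1 := measure_univ
  rwa [hκ m, Measure.smul_apply, withDensity_apply _ MeasurableSet.univ, Measure.restrict_univ,
    smul_eq_mul] at h

theorem multivariateGaussian_inv_const_ne {A : Matrix (Fin p) (Fin p) ℝ} {κ : ENNReal}
    (hκ : ∀ m, multivariateGaussian m A⁻¹ =
      κ • volume.withDensity fun β => ENNReal.ofReal (priorDensity A m β)) :
    κ ≠ 0 ∧ κ ≠ ⊤ := by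
  have h := lintegral_priorDensity_of_eq_withDensity hκ 0
  constructor
  · rintro rfl
    simp at h
  · rintro rfl
    rcases eq_or_ne (∫⁻ β, ENNReal.ofReal (priorDensity A 0 β)) 0 with h0 | h0
    · simp [h0] at h
    · simp [ENNReal.top_mul h0] at h

theorem integrable_norm_withDensity_priorDensity {A : Matrix (Fin p) (Fin p) ℝ} (hA : A.PosDef)
    (m : EuclideanSpace ℝ (Fin p)) :
    Integrable (fun β => ‖β‖) (volume.withDensity fun β => ENNReal.ofReal (priorDensity A m β)) := by
  obtain ⟨κ, hκ⟩ := multivariateGaussian_inv_eq_withDensity hA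
  obtain ⟨h0, h1⟩ := multivariateGaussian_inv_const_ne hκ
  have h : Integrable (fun β => ‖β‖) (multivariateGaussian m A⁻¹) :=
    IsGaussian.integrable_id.norm
  rw [hκ m] at h
  exact (integrable_smul_measure h0 h1).1 h

theorem isFiniteMeasure_withDensity_priorDensity {A : Matrix (Fin p) (Fin p) ℝ} (hA : A.PosDef)
    (m : EuclideanSpace ℝ (Fin p)) :
    IsFiniteMeasure (volume.withDensity fun β => ENNReal.ofReal (priorDensity A m β)) := by
  obtain ⟨κ, hκ⟩ := multivariateGaussian_inv_eq_withDensity hA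
  obtain ⟨h0, h1⟩ := multivariateGaussian_inv_const_ne hκ
  refine ⟨lt_top_iff_ne_top.2 fun h => ?_⟩
  rw [withDensity_apply _ MeasurableSet.univ, Measure.restrict_univ] at h
  have := lintegral_priorDensity_of_eq_withDensity hκ m
  rw [h, ENNReal.mul_top h0] at this
  exact ENNReal.top_ne_one this

/-! ### Lipschitz dependence of Gaussian measures on the mean. -/

theorem abs_exp_neg_sub_exp_neg_le {a b : ℝ} :
    |Real.exp (-a) - Real.exp (-b)| ≤ |a - b| * (Real.exp (-a) + Real.exp (-b)) := by
  wlog h : a ≤ b generalizing a b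
  · rw [abs_sub_comm, abs_sub_comm a, add_comm (Real.exp (-a))]
    exact this (le_of_not_ge h)
  rw [abs_of_nonneg (sub_nonneg.2 (Real.exp_le_exp.2 (neg_le_neg h))), abs_of_nonpos (by linarith)]
  have h1 : Real.exp (-b) = Real.exp (-a) * Real.exp (a - b) := by
    rw [← Real.exp_add]
    ring_nf
  have h2 := Real.add_one_le_exp (a - b)
  have h3 := Real.exp_pos (-a)
  have h4 := Real.exp_pos (-b)
  nlinarith [mul_le_mul_of_nonneg_left h2 h3.le, mul_nonneg (sub_nonneg.2 h) h4.le]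

theorem abs_quadForm_sub_le (A : Matrix (Fin p) (Fin p) ℝ) :
    ∃ C : ℝ, 0 ≤ C ∧ ∀ a b : EuclideanSpace ℝ (Fin p),
      |a.ofLp ⬝ᵥ (A *ᵥ a.ofLp) - b.ofLp ⬝ᵥ (A *ᵥ b.ofLp)| ≤ C * ‖a - b‖ * (‖a‖ + ‖b‖) := by
  refine ⟨‖toEuclideanCLM (𝕜 := ℝ) A‖, norm_nonneg _, fun a b => ?_⟩
  set T := toEuclideanCLM (𝕜 := ℝ) A
  have h : ∀ x : EuclideanSpace ℝ (Fin p), x.ofLp ⬝ᵥ (A *ᵥ x.ofLp) = inner ℝ x (T x) :=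
    fun x => (inner_toEuclideanCLM A x x).symm
  have h2 : inner ℝ a (T a) - inner ℝ b (T b) = inner ℝ (a - b) (T a) + inner ℝ b (T (a - b)) := by
    rw [map_sub, inner_sub_left, inner_sub_right]
    ring
  rw [h, h, h2]
  have h3 : |inner ℝ (a - b) (T a)| ≤ ‖a - b‖ * (‖T‖ * ‖a‖) :=
    (abs_real_inner_le_norm _ _).trans (by gcongr; exact T.le_opNorm a)
  have h4 : |inner ℝ b (T (a - b))| ≤ ‖b‖ * (‖T‖ * ‖a - b‖) :=
    (abs_real_inner_le_norm _ _).trans (by gcongr; exact T.le_opNorm _)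
  calc _ ≤ _ := abs_add_le _ _
    _ ≤ _ := add_le_add h3 h4
    _ = _ := by ring

theorem priorDensity_eq_sub (A : Matrix (Fin p) (Fin p) ℝ) (m β : EuclideanSpace ℝ (Fin p)) :
    priorDensity A m β = priorDensity A 0 (β - m) := by
  simp [priorDensity]

theorem integrable_priorDensity {A : Matrix (Fin p) (Fin p) ℝ} (hA : A.PosDef)
    (m : EuclideanSpace ℝ (Fin p)) : Integrable (priorDensity A m) volume := by
  have := isFiniteMeasure_withDensity_priorDensity hA m
  have h := (integrable_const (1 : ℝ) :
    Integrable _ (volume.withDensity fun β => ENNReal.ofReal (priorDensity A m β)))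
  rw [integrable_withDensity_iff_integrable_smul'
    (continuous_priorDensity A m).measurable.ennreal_ofReal
    (Filter.Eventually.of_forall fun _ => ENNReal.ofReal_lt_top)] at h
  simpa [ENNReal.toReal_ofReal (priorDensity_pos _ _ _).le] using h

theorem integrable_norm_mul_priorDensity {A : Matrix (Fin p) (Fin p) ℝ} (hA : A.PosDef) :
    Integrable (fun β => (2 * ‖β‖ + 1) * priorDensity A 0 β) volume := by
  have h := integrable_norm_withDensity_priorDensity hA 0
  rw [integrable_withDensity_iff_integrable_smul'
    (continuous_priorDensity A 0).measurable.ennreal_ofReal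
    (Filter.Eventually.of_forall fun _ => ENNReal.ofReal_lt_top)] at h
  refine ((h.const_mul 2).add (integrable_priorDensity hA 0)).congr
    (Filter.Eventually.of_forall fun β => ?_)
  simp only [Pi.add_apply, ENNReal.toReal_ofReal (priorDensity_pos _ _ _).le, smul_eq_mul]
  ring

/-- Gaussian measures with a common covariance depend on the mean in a Lipschitz way in total
variation. -/
theorem abs_multivariateGaussian_real_sub_le {A : Matrix (Fin p) (Fin p) ℝ} (hA : A.PosDef) :
    ∃ C : ℝ, 0 ≤ C ∧ ∀ (m m' : EuclideanSpace ℝ (Fin p)) (s : Set (EuclideanSpace ℝ (Fin p))),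
      MeasurableSet s → |(multivariateGaussian m A⁻¹).real s - (multivariateGaussian m' A⁻¹).real s|
        ≤ C * ‖m - m'‖ := by
  obtain ⟨κ, hκ⟩ := multivariateGaussian_inv_eq_withDensity hA
  obtain ⟨C, hC, hq⟩ := abs_quadForm_sub_le A
  set I := ∫ β, (2 * ‖β‖ + 1) * priorDensity A 0 β
  have hI0 : 0 ≤ I := integral_nonneg fun β => mul_nonneg (by positivity) (priorDensity_pos _ _ _).le
  -- The `1` covers means at distance at least one, where the trivial bound on probabilities
  -- suffices.
  refine ⟨max 1 (κ.toReal * (C * I)), le_max_of_le_left zero_le_one, fun m m' s hs => ?_⟩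
  rcases le_total 1 ‖m - m'‖ with h1 | h1
  · have ha : ∀ m, (multivariateGaussian m A⁻¹).real s ∈ Set.Icc (0 : ℝ) 1 := fun m =>
      ⟨measureReal_nonneg, measureReal_le_one⟩
    calc _ ≤ (1 : ℝ) := by
          rw [abs_le]
          constructor <;> linarith [(ha m).1, (ha m).2, (ha m').1, (ha m').2]
      _ ≤ 1 * ‖m - m'‖ := by linarith
      _ ≤ _ := by gcongr; exact le_max_left _ _
  have hreal : ∀ m, (multivariateGaussian m A⁻¹).real s
      = κ.toReal * ∫ β in s, priorDensity A m β := fun m => by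
    rw [measureReal_def, hκ m, Measure.smul_apply, withDensity_apply _ hs, smul_eq_mul,
      ENNReal.toReal_mul, integral_eq_lintegral_of_nonneg_ae
        (Filter.Eventually.of_forall fun β => (priorDensity_pos _ _ _).le)
        (continuous_priorDensity A m).aestronglyMeasurable]
  have hintg := integrable_norm_mul_priorDensity hA
  -- Since `‖m - m'‖ ≤ 1`, each of `‖β - m‖`, `‖β - m'‖` is at most the other plus one. The bound
  -- therefore splits into two terms, each centred at one mean, whose integrals are both `I` by
  -- translation.
  have hpt : ∀ β, |priorDensity A m β - priorDensity A m' β| ≤ C * ‖m - m'‖ *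
      (((2 * ‖β - m‖ + 1) * priorDensity A 0 (β - m)
        + (2 * ‖β - m'‖ + 1) * priorDensity A 0 (β - m')) / 2) := fun β => by
    rw [← priorDensity_eq_sub, ← priorDensity_eq_sub]
    have hab : (β - m') - (β - m) = m - m' := by abel
    have hn1 : ‖β - m'‖ ≤ ‖β - m‖ + 1 := by
      have := norm_add_le (β - m) (m - m')
      rw [sub_add_sub_cancel] at this
      linarith
    have hn2 : ‖β - m‖ ≤ ‖β - m'‖ + 1 := by
      have := norm_add_le (β - m') (m' - m)
      rw [sub_add_sub_cancel, norm_sub_rev m'] at this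
      linarith
    have h2 := hq (β - m) (β - m')
    rw [norm_sub_rev (β - m), hab] at h2
    have h3 := abs_exp_neg_sub_exp_neg_le (a := ((β - m).ofLp ⬝ᵥ (A *ᵥ (β - m).ofLp)) / 2)
      (b := ((β - m').ofLp ⬝ᵥ (A *ᵥ (β - m').ofLp)) / 2)
    rw [← sub_div, abs_div, abs_two] at h3
    change |priorDensity A m β - priorDensity A m' β| ≤
      _ * (priorDensity A m β + priorDensity A m' β) at h3
    have p1 := priorDensity_pos A m β
    have p2 := priorDensity_pos A m' β
    calc _ ≤ _ := h3
      _ ≤ C * ‖m - m'‖ * (‖β - m‖ + ‖β - m'‖) / 2 *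
          (priorDensity A m β + priorDensity A m' β) := by gcongr
      _ = C * ‖m - m'‖ * (((‖β - m‖ + ‖β - m'‖) * priorDensity A m β
          + (‖β - m‖ + ‖β - m'‖) * priorDensity A m' β) / 2) := by ring
      _ ≤ _ := by
        have e1 := mul_le_mul_of_nonneg_right
          (show ‖β - m‖ + ‖β - m'‖ ≤ 2 * ‖β - m‖ + 1 by linarith) p1.le
        have e2 := mul_le_mul_of_nonneg_right
          (show ‖β - m‖ + ‖β - m'‖ ≤ 2 * ‖β - m'‖ + 1 by linarith) p2.le
        exact mul_le_mul_of_nonneg_left (by linarith) (by positivity)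
  have hi1 := hintg.comp_sub_right m
  have hi2 := hintg.comp_sub_right m'
  rw [hreal, hreal, ← mul_sub, abs_mul, abs_of_nonneg ENNReal.toReal_nonneg,
    ← integral_sub (integrable_priorDensity hA m).integrableOn
      (integrable_priorDensity hA m').integrableOn]
  calc κ.toReal * |∫ β in s, (priorDensity A m β - priorDensity A m' β)|
      ≤ κ.toReal * ∫ β in s, |priorDensity A m β - priorDensity A m' β| := by
        gcongr
        exact abs_integral_le_integral_abs
    _ ≤ κ.toReal * ∫ β, |priorDensity A m β - priorDensity A m' β| := by
        gcongr ?_ * ?_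
        exact setIntegral_le_integral
          ((integrable_priorDensity hA m).sub (integrable_priorDensity hA m')).abs
          (Filter.Eventually.of_forall fun β => abs_nonneg _)
    _ ≤ κ.toReal * ∫ β, C * ‖m - m'‖ * (((2 * ‖β - m‖ + 1) * priorDensity A 0 (β - m)
          + (2 * ‖β - m'‖ + 1) * priorDensity A 0 (β - m')) / 2) := by
        gcongr ?_ * ?_
        exact integral_mono
          ((integrable_priorDensity hA m).sub (integrable_priorDensity hA m')).abs
          (((hi1.add hi2).div_const 2).const_mul _) hpt
    _ = κ.toReal * (C * ‖m - m'‖ * ((I + I) / 2)) := by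
        rw [integral_const_mul, integral_div, integral_add hi1 hi2,
          integral_sub_right_eq_self (fun β => (2 * ‖β‖ + 1) * priorDensity A 0 β) m,
          integral_sub_right_eq_self (fun β => (2 * ‖β‖ + 1) * priorDensity A 0 β) m']
    _ = κ.toReal * (C * I) * ‖m - m'‖ := by ring
    _ ≤ _ := by gcongr; exact le_max_right _ _

end GaussianDensity

/-! ### Invariance of the posterior -/

section Invariance

variable {n p : ℕ}

/-- The likelihood contribution of a single observation with linear predictor `θ`. -/
noncomputable def probitTerm (y : Bool) (θ : ℝ) : ℝ :=
  if y then stdNormalCDF θ else 1 - stdNormalCDF θ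

theorem measurable_probitTerm (y : Bool) : Measurable (probitTerm y) := by
  have : Measurable stdNormalCDF := (monotone_cdf _).measurable
  cases y
  · exact measurable_const.sub this
  · exact this

theorem gaussianReal_truncSet (θ : ℝ) (y : Bool) :
    gaussianReal θ 1 (truncSet y) = ENNReal.ofReal (probitTerm y θ) := by
  -- Reflecting about `θ / 2` turns positivity of the latent variable into a standard normal lying
  -- below `θ`.
  have h : gaussianReal θ 1 = (gaussianReal 0 1).map (fun x => θ - x) := by
    rw [gaussianReal_map_const_sub, sub_zero]
  have : NullSingletonClass (gaussianReal 0 1) := nullSingletonClass_gaussianReal one_ne_zero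
  rw [h, Measure.map_apply (by fun_prop) (measurableSet_truncSet y)]
  cases y
  · have hs : (fun x => θ - x) ⁻¹' truncSet false = (Set.Iic θ)ᶜ := by
      ext x
      simp [truncSet]
    rw [hs, prob_compl_eq_one_sub measurableSet_Iic, probitTerm, if_neg Bool.false_ne_true,
      stdNormalCDF, ENNReal.ofReal_sub _ (cdf_nonneg _ _), ofReal_cdf, ENNReal.ofReal_one]
  · have hs : (fun x => θ - x) ⁻¹' truncSet true = Set.Iio θ := by
      ext x
      simp [truncSet]
    rw [hs, probitTerm, if_pos rfl, stdNormalCDF, ofReal_cdf]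
    exact measure_congr Iio_ae_eq_Iic

theorem probitTerm_pos (y : Bool) (θ : ℝ) : 0 < probitTerm y θ := by
  have := gaussianReal_truncSet_ne_zero θ y
  rwa [gaussianReal_truncSet, ne_eq, ENNReal.ofReal_eq_zero, not_le] at this

theorem probitTerm_le_one (y : Bool) (θ : ℝ) : probitTerm y θ ≤ 1 := by
  have : gaussianReal θ 1 (truncSet y) ≤ 1 := prob_le_one
  rwa [gaussianReal_truncSet, ENNReal.ofReal_le_one] at this

theorem probitLikelihood_eq_prod (X : Matrix (Fin n) (Fin p) ℝ) (Y : Fin n → Bool)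
    (β : EuclideanSpace ℝ (Fin p)) :
    probitLikelihood X Y β = ∏ i, probitTerm (Y i) ((X *ᵥ β.ofLp) i) := rfl

theorem probitLikelihood_pos (X : Matrix (Fin n) (Fin p) ℝ) (Y : Fin n → Bool)
    (β : EuclideanSpace ℝ (Fin p)) : 0 < probitLikelihood X Y β :=
  Finset.prod_pos fun _ _ => probitTerm_pos _ _

theorem probitLikelihood_le_one (X : Matrix (Fin n) (Fin p) ℝ) (Y : Fin n → Bool)
    (β : EuclideanSpace ℝ (Fin p)) : probitLikelihood X Y β ≤ 1 :=
  Finset.prod_le_one (fun _ _ => (probitTerm_pos _ _).le) fun _ _ => probitTerm_le_one _ _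

theorem measurable_mulVec_apply (X : Matrix (Fin n) (Fin p) ℝ) (i : Fin n) :
    Measurable fun β : EuclideanSpace ℝ (Fin p) => (X *ᵥ β.ofLp) i := by
  simp only [Matrix.mulVec, dotProduct]
  fun_prop

theorem measurable_probitLikelihood (X : Matrix (Fin n) (Fin p) ℝ) (Y : Fin n → Bool) :
    Measurable (probitLikelihood X Y) :=
  Finset.measurable_prod _ fun i _ =>
    (measurable_probitTerm (Y i)).comp (measurable_mulVec_apply X i)

theorem measurable_posteriorDensity (X : Matrix (Fin n) (Fin p) ℝ) (Y : Fin n → Bool)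
    (Q : Matrix (Fin p) (Fin p) ℝ) (v : EuclideanSpace ℝ (Fin p)) :
    Measurable fun β => ENNReal.ofReal (probitLikelihood X Y β * priorDensity Q v β) :=
  ((measurable_probitLikelihood X Y).mul (continuous_priorDensity Q v).measurable).ennreal_ofReal

/-- The joint density of coefficients and latent variables, up to normalization. -/
noncomputable def jointDensity (X : Matrix (Fin n) (Fin p) ℝ) (Y : Fin n → Bool)
    (Q : Matrix (Fin p) (Fin p) ℝ) (v β : EuclideanSpace ℝ (Fin p)) (z : Fin n → ℝ) : ENNReal :=
  ENNReal.ofReal (priorDensity Q v β) *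
    ∏ i, (truncSet (Y i)).indicator (gaussianPDF ((X *ᵥ β.ofLp) i) 1) (z i)

theorem measurable_jointDensity (X : Matrix (Fin n) (Fin p) ℝ) (Y : Fin n → Bool)
    (Q : Matrix (Fin p) (Fin p) ℝ) (v : EuclideanSpace ℝ (Fin p)) :
    Measurable (Function.uncurry (jointDensity X Y Q v)) := by
  refine ((continuous_priorDensity Q v).measurable.ennreal_ofReal.comp measurable_fst).mul
    (Finset.measurable_prod _ fun i _ => ?_)
  have h : Measurable fun q : EuclideanSpace ℝ (Fin p) × (Fin n → ℝ) =>
      gaussianPDF ((X *ᵥ q.1.ofLp) i) 1 (q.2 i) :=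
    measurable_uncurry_gaussianPDF.comp
      (((measurable_mulVec_apply X i).comp measurable_fst).prodMk
        (measurable_const.prodMk ((measurable_pi_apply i).comp measurable_snd)))
  have hs : MeasurableSet {q : EuclideanSpace ℝ (Fin p) × (Fin n → ℝ) | q.2 i ∈ truncSet (Y i)} :=
    ((measurable_pi_apply i).comp measurable_snd) (measurableSet_truncSet (Y i))
  exact h.indicator hs

theorem truncNormal_eq_withDensity (θ : ℝ) (y : Bool) :
    truncNormal θ y = volume.withDensity fun x => (ENNReal.ofReal (probitTerm y θ))⁻¹ *
      (truncSet y).indicator (gaussianPDF θ 1) x := by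
  have hm := measurableSet_truncSet y
  rw [truncNormal, ProbabilityTheory.cond, gaussianReal_truncSet]
  change _ = volume.withDensity ((ENNReal.ofReal (probitTerm y θ))⁻¹ •
    (truncSet y).indicator (gaussianPDF θ 1))
  rw [withDensity_smul _ ((measurable_gaussianPDF _ _).indicator hm), withDensity_indicator hm,
    gaussianReal_of_var_ne_zero _ one_ne_zero, restrict_withDensity hm]

theorem latentKernel_eq_withDensity (X : Matrix (Fin n) (Fin p) ℝ) (Y : Fin n → Bool)
    (β : EuclideanSpace ℝ (Fin p)) :
    latentKernel X Y β = volume.withDensity fun z => (ENNReal.ofReal (probitLikelihood X Y β))⁻¹ *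
      ∏ i, (truncSet (Y i)).indicator (gaussianPDF ((X *ᵥ β.ofLp) i) 1) (z i) := by
  have h : latentKernel X Y β = Measure.pi fun i => truncNormal ((X *ᵥ β.ofLp) i) (Y i) := rfl
  rw [h]
  simp only [truncNormal_eq_withDensity]
  rw [pi_withDensity]
  · congr 1
    funext z
    rw [Finset.prod_mul_distrib, probitLikelihood_eq_prod,
      ENNReal.ofReal_prod_of_nonneg fun i _ => (probitTerm_pos _ _).le, ENNReal.prod_inv_distrib]
    exact fun i _ j _ _ => .inr ENNReal.ofReal_ne_top
  · exact fun i => measurable_const.mul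
      ((measurable_gaussianPDF _ _).indicator (measurableSet_truncSet _))
  · intro i
    rw [← truncNormal_eq_withDensity]
    infer_instance

/-- One of two disintegrations of the joint density: the `β` marginal is the unnormalized posterior,
and the law of `z` given `β` is the latent step. -/
theorem lintegral_jointDensity_mul (X : Matrix (Fin n) (Fin p) ℝ) (Y : Fin n → Bool)
    (Q : Matrix (Fin p) (Fin p) ℝ) (v β : EuclideanSpace ℝ (Fin p)) {F : (Fin n → ℝ) → ENNReal}
    (hF : Measurable F) :
    ∫⁻ z, jointDensity X Y Q v β z * F z =
      ENNReal.ofReal (probitLikelihood X Y β * priorDensity Q v β) *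
        ∫⁻ z, F z ∂latentKernel X Y β := by
  have hm : Measurable fun z : Fin n → ℝ =>
      ∏ i, (truncSet (Y i)).indicator (gaussianPDF ((X *ᵥ β.ofLp) i) 1) (z i) :=
    Finset.measurable_prod _ fun i _ => ((measurable_gaussianPDF _ _).indicator
      (measurableSet_truncSet _)).comp (measurable_pi_apply i)
  have hm' := hm.const_mul (ENNReal.ofReal (probitLikelihood X Y β))⁻¹
  rw [latentKernel_eq_withDensity, lintegral_withDensity_eq_lintegral_mul _ hm' hF,
    ← lintegral_const_mul _ (hm'.mul hF)]
  congr 1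
  funext z
  have h0 : ENNReal.ofReal (probitLikelihood X Y β) ≠ 0 :=
    (ENNReal.ofReal_pos.2 (probitLikelihood_pos X Y β)).ne'
  rw [ENNReal.ofReal_mul (probitLikelihood_pos X Y β).le, jointDensity, Pi.mul_apply]
  calc _ = 1 * (ENNReal.ofReal (priorDensity Q v β) *
        (∏ i, (truncSet (Y i)).indicator (gaussianPDF ((X *ᵥ β.ofLp) i) 1) (z i)) * F z) := by
        rw [one_mul]
    _ = _ := by
      rw [← ENNReal.mul_inv_cancel h0 ENNReal.ofReal_ne_top]
      ring

/-- Completing the square: given the latent variables, the coefficients are Gaussian. -/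
theorem exists_jointDensity_eq_mul (X : Matrix (Fin n) (Fin p) ℝ) (Y : Fin n → Bool)
    {Q : Matrix (Fin p) (Fin p) ℝ} (hQ : Q.PosDef) (v : EuclideanSpace ℝ (Fin p)) (z : Fin n → ℝ) :
    ∃ H : ENNReal, ∀ β, jointDensity X Y Q v β z =
      H * ENNReal.ofReal (priorDensity (sigmaMatrix X Q) (condMean X Q v z) β) := by
  have hQt : Qᵀ = Q := by simpa using hQ.isHermitian.eq
  have hS := sigmaMatrix_posDef X hQ
  have hSt : (sigmaMatrix X Q)ᵀ = sigmaMatrix X Q := by simpa using hS.isHermitian.eq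
  have hadj : ∀ (a : Fin p → ℝ) (b : Fin n → ℝ), a ⬝ᵥ (Xᵀ *ᵥ b) = (X *ᵥ a) ⬝ᵥ b := fun a b => by
    rw [dotProduct_mulVec, vecMul_transpose]
  by_cases hz : ∀ i, z i ∈ truncSet (Y i)
  · set m := (condMean X Q v z).ofLp with hm
    -- The exponent is what remains after completing the square in `β`.
    refine ⟨ENNReal.ofReal ((∏ _i : Fin n, (√(2 * Real.pi * (1 : NNReal)))⁻¹) *
      Real.exp (-((v.ofLp ⬝ᵥ (Q *ᵥ v.ofLp) + z ⬝ᵥ z - m ⬝ᵥ (sigmaMatrix X Q *ᵥ m)) / 2))),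
      fun β => ?_⟩
    rw [jointDensity, Finset.prod_congr rfl fun i _ => Set.indicator_of_mem (hz i) _]
    simp only [gaussianPDF]
    rw [← ENNReal.ofReal_prod_of_nonneg fun i _ => gaussianPDFReal_nonneg _ _ _,
      ← ENNReal.ofReal_mul (priorDensity_pos _ _ _).le, ← ENNReal.ofReal_mul (by positivity)]
    congr 1
    simp only [gaussianPDFReal, priorDensity]
    rw [Finset.prod_mul_distrib, ← Real.exp_sum, mul_left_comm, ← Real.exp_add,
      mul_assoc (∏ _i : Fin n, _), ← Real.exp_add]
    congr 2
    have hsum : ∑ i, -(z i - (X *ᵥ β.ofLp) i) ^ 2 / (2 * ((1 : NNReal) : ℝ))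
        = -(((z - X *ᵥ β.ofLp) ⬝ᵥ (z - X *ᵥ β.ofLp)) / 2) := by
      simp [dotProduct, sq, Finset.sum_div, neg_div]
    have hSm : sigmaMatrix X Q *ᵥ m = Xᵀ *ᵥ z + Q *ᵥ v.ofLp := by
      rw [hm, condMean, mulVec_mulVec, mul_nonsing_inv _ ((isUnit_iff_isUnit_det _).1 hS.isUnit),
        one_mulVec]
    have hsymQ : v.ofLp ⬝ᵥ (Q *ᵥ β.ofLp) = β.ofLp ⬝ᵥ (Q *ᵥ v.ofLp) := by
      rw [dotProduct_mulVec, ← hQt, vecMul_transpose, hQt, dotProduct_comm]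
    have hsymS : m ⬝ᵥ (sigmaMatrix X Q *ᵥ β.ofLp) = β.ofLp ⬝ᵥ (sigmaMatrix X Q *ᵥ m) := by
      rw [dotProduct_mulVec, ← hSt, vecMul_transpose, hSt, dotProduct_comm]
    have hbSm : β.ofLp ⬝ᵥ (sigmaMatrix X Q *ᵥ m) =
        (X *ᵥ β.ofLp) ⬝ᵥ z + β.ofLp ⬝ᵥ (Q *ᵥ v.ofLp) := by
      rw [hSm, dotProduct_add, hadj]
    have hbSb : β.ofLp ⬝ᵥ (sigmaMatrix X Q *ᵥ β.ofLp) =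
        (X *ᵥ β.ofLp) ⬝ᵥ (X *ᵥ β.ofLp) + β.ofLp ⬝ᵥ (Q *ᵥ β.ofLp) := by
      rw [sigmaMatrix, add_mulVec, ← mulVec_mulVec, dotProduct_add, hadj]
    have hzX : z ⬝ᵥ (X *ᵥ β.ofLp) = (X *ᵥ β.ofLp) ⬝ᵥ z := dotProduct_comm _ _
    rw [hsum]
    simp only [WithLp.ofLp_sub, ← hm, mulVec_sub, sub_dotProduct, dotProduct_sub, hsymQ, hsymS,
      hbSm, hbSb, hzX]
    ring
  · refine ⟨0, fun β => ?_⟩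
    push Not at hz
    obtain ⟨i, hi⟩ := hz
    rw [jointDensity, Finset.prod_eq_zero (Finset.mem_univ i) (Set.indicator_of_notMem hi _),
      mul_zero, zero_mul]

/-- The other disintegration, with `β` drawn given `z`. The product form avoids dividing by a
marginal that vanishes off the truncation region. -/
theorem coefKernel_mul_lintegral_jointDensity (X : Matrix (Fin n) (Fin p) ℝ) (Y : Fin n → Bool)
    {Q : Matrix (Fin p) (Fin p) ℝ} (hQ : Q.PosDef) (v : EuclideanSpace ℝ (Fin p)) (z : Fin n → ℝ)
    {s : Set (EuclideanSpace ℝ (Fin p))} (hs : MeasurableSet s) :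
    (∫⁻ β, jointDensity X Y Q v β z) * coefKernel X Q v z s = ∫⁻ β in s, jointDensity X Y Q v β z := by
  obtain ⟨H, hH⟩ := exists_jointDensity_eq_mul X Y hQ v z
  obtain ⟨κ, hκ⟩ := multivariateGaussian_inv_eq_withDensity (sigmaMatrix_posDef X hQ)
  have hm := (continuous_priorDensity (sigmaMatrix X Q) (condMean X Q v z)).measurable.ennreal_ofReal
  have hc : coefKernel X Q v z s = κ * ∫⁻ β in s,
      ENNReal.ofReal (priorDensity (sigmaMatrix X Q) (condMean X Q v z) β) := by
    change multivariateGaussian (condMean X Q v z) (sigmaMatrix X Q)⁻¹ s = _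
    rw [hκ, Measure.smul_apply, withDensity_apply _ hs, smul_eq_mul]
  simp only [hH]
  rw [lintegral_const_mul _ hm, lintegral_const_mul _ hm, hc]
  calc _ = H * (κ * ∫⁻ β, ENNReal.ofReal
          (priorDensity (sigmaMatrix X Q) (condMean X Q v z) β)) * ∫⁻ β in s,
          ENNReal.ofReal (priorDensity (sigmaMatrix X Q) (condMean X Q v z) β) := by ring
    _ = _ := by rw [lintegral_priorDensity_of_eq_withDensity hκ, mul_one]

/-- The chain is a two-block Gibbs sampler: both steps are conditionals of the same joint density,
so Tonelli, applied twice, returns its `β` marginal. -/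
theorem unnormalizedPosterior_bind_acKernel (X : Matrix (Fin n) (Fin p) ℝ) (Y : Fin n → Bool)
    {Q : Matrix (Fin p) (Fin p) ℝ} (hQ : Q.PosDef) (v : EuclideanSpace ℝ (Fin p)) :
    (unnormalizedPosterior X Y Q v).bind (acKernel X Y Q v) = unnormalizedPosterior X Y Q v := by
  ext s hs
  have hF : Measurable fun z => coefKernel X Q v z s := Kernel.measurable_coe _ hs
  have hJ := measurable_jointDensity X Y Q v
  have hJF : Measurable (Function.uncurry fun β z =>
      jointDensity X Y Q v β z * coefKernel X Q v z s) := hJ.mul (hF.comp measurable_snd)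
  rw [Measure.bind_apply hs (Kernel.aemeasurable _), unnormalizedPosterior, withDensity_apply _ hs,
    lintegral_withDensity_eq_lintegral_mul _ (measurable_posteriorDensity X Y Q v)
      (Kernel.measurable_coe _ hs)]
  calc _ = ∫⁻ β, ∫⁻ z, jointDensity X Y Q v β z * coefKernel X Q v z s := by
        refine lintegral_congr fun β => ?_
        rw [lintegral_jointDensity_mul X Y Q v β hF, Pi.mul_apply, acKernel,
          Kernel.comp_apply' _ _ _ hs]
    _ = ∫⁻ z, ∫⁻ β, jointDensity X Y Q v β z * coefKernel X Q v z s :=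
        lintegral_lintegral_swap hJF.aemeasurable
    _ = ∫⁻ z, ∫⁻ β in s, jointDensity X Y Q v β z := by
        refine lintegral_congr fun z => ?_
        have hJz : Measurable fun β => jointDensity X Y Q v β z := hJ.of_uncurry_right
        rw [lintegral_mul_const _ hJz]
        exact coefKernel_mul_lintegral_jointDensity X Y hQ v z hs
    _ = ∫⁻ β in s, ∫⁻ z, jointDensity X Y Q v β z :=
        (lintegral_lintegral_swap hJ.aemeasurable).symm
    _ = _ := by
        refine lintegral_congr fun β => ?_
        have h := lintegral_jointDensity_mul X Y Q v β (F := fun _ => 1) measurable_const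
        simpa using h

theorem unnormalizedPosterior_le (X : Matrix (Fin n) (Fin p) ℝ) (Y : Fin n → Bool)
    (Q : Matrix (Fin p) (Fin p) ℝ) (v : EuclideanSpace ℝ (Fin p)) :
    unnormalizedPosterior X Y Q v ≤
      volume.withDensity fun β => ENNReal.ofReal (priorDensity Q v β) :=
  withDensity_mono (Filter.Eventually.of_forall fun β => ENNReal.ofReal_le_ofReal
    (mul_le_of_le_one_left (priorDensity_pos _ _ _).le (probitLikelihood_le_one X Y β)))

theorem unnormalizedPosterior_univ_ne_zero (X : Matrix (Fin n) (Fin p) ℝ) (Y : Fin n → Bool)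
    (Q : Matrix (Fin p) (Fin p) ℝ) (v : EuclideanSpace ℝ (Fin p)) :
    unnormalizedPosterior X Y Q v Set.univ ≠ 0 := by
  rw [unnormalizedPosterior, withDensity_apply _ MeasurableSet.univ, Measure.restrict_univ, ne_eq,
    lintegral_eq_zero_iff (measurable_posteriorDensity X Y Q v)]
  intro h
  have hfalse : ∀ᵐ β : EuclideanSpace ℝ (Fin p), False := by
    filter_upwards [h] with β hβ
    exact (ENNReal.ofReal_pos.2
      (mul_pos (probitLikelihood_pos X Y β) (priorDensity_pos Q v β))).ne' hβ
  exact hfalse.exists.elim fun _ h => h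

theorem unnormalizedPosterior_univ_ne_top (X : Matrix (Fin n) (Fin p) ℝ) (Y : Fin n → Bool)
    {Q : Matrix (Fin p) (Fin p) ℝ} (hQ : Q.PosDef) (v : EuclideanSpace ℝ (Fin p)) :
    unnormalizedPosterior X Y Q v Set.univ ≠ ⊤ := by
  have := isFiniteMeasure_withDensity_priorDensity hQ v
  exact ((unnormalizedPosterior_le X Y Q v _).trans_lt (measure_lt_top _ _)).ne

theorem isProbabilityMeasure_probitPosterior (X : Matrix (Fin n) (Fin p) ℝ) (Y : Fin n → Bool)
    {Q : Matrix (Fin p) (Fin p) ℝ} (hQ : Q.PosDef) (v : EuclideanSpace ℝ (Fin p)) :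
    IsProbabilityMeasure (probitPosterior X Y Q v) :=
  ⟨by rw [probitPosterior, Measure.smul_apply, smul_eq_mul, ENNReal.inv_mul_cancel
    (unnormalizedPosterior_univ_ne_zero X Y Q v) (unnormalizedPosterior_univ_ne_top X Y hQ v)]⟩

theorem integrable_norm_probitPosterior (X : Matrix (Fin n) (Fin p) ℝ) (Y : Fin n → Bool)
    {Q : Matrix (Fin p) (Fin p) ℝ} (hQ : Q.PosDef) (v : EuclideanSpace ℝ (Fin p)) :
    Integrable (fun β => ‖β‖) (probitPosterior X Y Q v) :=
  ((integrable_norm_withDensity_priorDensity hQ v).mono_measure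
    (unnormalizedPosterior_le X Y Q v)).smul_measure
    (ENNReal.inv_ne_top.2 (unnormalizedPosterior_univ_ne_zero X Y Q v))

theorem invariant_acKernel_probitPosterior (X : Matrix (Fin n) (Fin p) ℝ) (Y : Fin n → Bool)
    {Q : Matrix (Fin p) (Fin p) ℝ} (hQ : Q.PosDef) (v : EuclideanSpace ℝ (Fin p)) :
    (probitPosterior X Y Q v).bind (acKernel X Y Q v) = probitPosterior X Y Q v := by
  rw [probitPosterior, Measure.bind_smul, unnormalizedPosterior_bind_acKernel X Y hQ v]

end Invariance

/-! ### Geometric convergence -/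

section Convergence

theorem tvDist_le_of_forall {S : Type*} [MeasurableSpace S] {μ ν : Measure S} {C : ℝ}
    (h : ∀ s, MeasurableSet s → |μ.real s - ν.real s| ≤ C) : tvDist μ ν ≤ C := by
  have : Nonempty {A : Set S // MeasurableSet A} := ⟨⟨∅, MeasurableSet.empty⟩⟩
  exact ciSup_le fun A => h A.1 A.2

theorem abs_real_sub_real_le_one {S : Type*} [MeasurableSpace S] (μ ν : Measure S)
    [IsProbabilityMeasure μ] [IsProbabilityMeasure ν] (s : Set S) : |μ.real s - ν.real s| ≤ 1 := by
  have h1 : μ.real s ≤ 1 := measureReal_le_one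
  have h2 : ν.real s ≤ 1 := measureReal_le_one
  have h3 : 0 ≤ μ.real s := measureReal_nonneg
  have h4 : 0 ≤ ν.real s := measureReal_nonneg
  rw [abs_le]
  constructor <;> linarith

theorem isMarkovKernel_pow {S : Type*} [MeasurableSpace S] (K : Kernel S S) [IsMarkovKernel K]
    (m : ℕ) : IsMarkovKernel (K ^ m) := by
  induction m with
  | zero => exact inferInstanceAs (IsMarkovKernel Kernel.id)
  | succ m ih =>
    rw [pow_succ]
    exact inferInstanceAs (IsMarkovKernel ((K ^ m) ∘ₖ K))

theorem bind_pow_of_bind_eq {S : Type*} [MeasurableSpace S] {K : Kernel S S} {π : Measure S}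
    (h : π.bind K = π) (m : ℕ) : π.bind (K ^ m) = π := by
  induction m with
  | zero => exact Measure.id_comp
  | succ m ih =>
    calc π.bind (K ^ (m + 1)) = (π.bind K).bind (K ^ m) := by
          rw [pow_succ]
          exact Measure.comp_assoc.symm
      _ = π := by rw [h, ih]

theorem bind_real_apply {S T : Type*} [MeasurableSpace S] [MeasurableSpace T] (K : Kernel S T)
    [IsMarkovKernel K] (μ : Measure S) {s : Set T} (hs : MeasurableSet s) :
    (μ.bind K).real s = ∫ x, (K x).real s ∂μ := by
  rw [measureReal_def, Measure.bind_apply hs K.aemeasurable]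
  exact (integral_toReal (K.measurable_coe hs).aemeasurable
    (Filter.Eventually.of_forall fun x => measure_lt_top _ _)).symm

theorem measurable_kernel_real {S T : Type*} [MeasurableSpace S] [MeasurableSpace T]
    (K : Kernel S T) {s : Set T} (hs : MeasurableSet s) : Measurable fun x => (K x).real s :=
  (K.measurable_coe hs).ennreal_toReal

/-! ### Contraction, smoothing and convergence of the Albert and Chib kernel. -/

variable {n p : ℕ}

instance (X : Matrix (Fin n) (Fin p) ℝ) (Q : Matrix (Fin p) (Fin p) ℝ)
    (v : EuclideanSpace ℝ (Fin p)) : IsMarkovKernel (coefKernel X Q v) :=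
  ⟨fun z => inferInstanceAs
    (IsProbabilityMeasure (multivariateGaussian (condMean X Q v z) (sigmaMatrix X Q)⁻¹))⟩

instance (X : Matrix (Fin n) (Fin p) ℝ) (Y : Fin n → Bool) (Q : Matrix (Fin p) (Fin p) ℝ)
    (v : EuclideanSpace ℝ (Fin p)) : IsMarkovKernel (acKernel X Y Q v) :=
  inferInstanceAs (IsMarkovKernel (coefKernel X Q v ∘ₖ latentKernel X Y))

theorem linPred_add (X : Matrix (Fin n) (Fin p) ℝ) (β β' : EuclideanSpace ℝ (Fin p)) :
    linPred X (β + β') = linPred X β + linPred X β' := by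
  simp [linPred, mulVec_add]

/-- Synchronous coupling: the noise `x` has the same law and the same linear map for every `z`, so
it cancels in differences. -/
theorem integral_coefKernel_eq (X : Matrix (Fin n) (Fin p) ℝ) (Q : Matrix (Fin p) (Fin p) ℝ)
    (v : EuclideanSpace ℝ (Fin p)) {f : EuclideanSpace ℝ (Fin p) → ℝ} (hf : Measurable f)
    (z : Fin n → ℝ) :
    ∫ β, f β ∂coefKernel X Q v z = ∫ x, f (condMean X Q v z +
      toEuclideanCLM (𝕜 := ℝ) (CFC.sqrt (sigmaMatrix X Q)⁻¹) x)
        ∂stdGaussian (EuclideanSpace ℝ (Fin p)) := by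
  change ∫ β, f β ∂multivariateGaussian (condMean X Q v z) (sigmaMatrix X Q)⁻¹ = _
  rw [multivariateGaussian, integral_map (by fun_prop) hf.aestronglyMeasurable]

/-- One step of the chain contracts the Lipschitz constant in the linear predictors. -/
theorem abs_integral_acKernel_sub_le (X : Matrix (Fin n) (Fin p) ℝ) (Y : Fin n → Bool)
    {Q : Matrix (Fin p) (Fin p) ℝ} (hQ : Q.PosDef) {c : ℝ} (hc : 0 < c)
    (hX : lambdaMax (X * Q⁻¹ * Xᵀ) < c) (v : EuclideanSpace ℝ (Fin p))
    {f : EuclideanSpace ℝ (Fin p) → ℝ} (hf : Measurable f) (hf1 : ∀ β, |f β| ≤ 1) {L : ℝ}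
    (hL : 0 ≤ L) (hLip : ∀ β β', |f β - f β'| ≤ L * ‖linPred X β - linPred X β'‖)
    (β β' : EuclideanSpace ℝ (Fin p)) :
    |∫ x, f x ∂acKernel X Y Q v β - ∫ x, f x ∂acKernel X Y Q v β'|
      ≤ L * (c / (1 + c)) * ‖linPred X β - linPred X β'‖ := by
  have hcomp : ∀ β, ∫ x, f x ∂acKernel X Y Q v β
      = ∫ z, ∫ x, f x ∂coefKernel X Q v z ∂latentKernel X Y β := fun β =>
    Kernel.integral_comp (Integrable.of_bound hf.aestronglyMeasurable 1
      (Filter.Eventually.of_forall fun x => hf1 x))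
  rw [hcomp, hcomp]
  refine abs_integral_latentKernel_sub_le X Y (C := 1)
    hf.stronglyMeasurable.integral_kernel.measurable (by positivity) (fun z => ?_)
    (fun z z' => ?_) β β'
  · rw [← Real.norm_eq_abs]
    refine (norm_integral_le_of_norm_le_const
      (Filter.Eventually.of_forall fun x => hf1 x)).trans_eq (by rw [probReal_univ, mul_one])
  · have hi : ∀ z, Integrable (fun x => f (condMean X Q v z +
        toEuclideanCLM (𝕜 := ℝ) (CFC.sqrt (sigmaMatrix X Q)⁻¹) x))
        (stdGaussian (EuclideanSpace ℝ (Fin p))) := fun z =>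
      Integrable.of_bound (hf.comp (by fun_prop)).aestronglyMeasurable 1
        (Filter.Eventually.of_forall fun x => hf1 _)
    rw [integral_coefKernel_eq X Q v hf, integral_coefKernel_eq X Q v hf,
      ← integral_sub (hi z) (hi z'), ← Real.norm_eq_abs]
    refine (norm_integral_le_of_norm_le_const (Filter.Eventually.of_forall fun x => ?_)).trans_eq
      (by rw [probReal_univ, mul_one])
    refine (hLip _ _).trans ?_
    rw [linPred_add, linPred_add, add_sub_add_right_eq_sub, mul_assoc]
    exact mul_le_mul_of_nonneg_left (norm_linPred_condMean_sub_le X hQ hc hX v z z') hL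

/-- Smoothing: an indicator is not Lipschitz, but one Gaussian draw makes it so in the mean, and the
latent step turns this into Lipschitz dependence on `X β`. -/
theorem exists_lipschitz_acKernel_real (X : Matrix (Fin n) (Fin p) ℝ) (Y : Fin n → Bool)
    {Q : Matrix (Fin p) (Fin p) ℝ} (hQ : Q.PosDef) (v : EuclideanSpace ℝ (Fin p)) :
    ∃ C : ℝ, 0 ≤ C ∧ ∀ s, MeasurableSet s → ∀ β β',
      |(acKernel X Y Q v β).real s - (acKernel X Y Q v β').real s|
        ≤ C * ‖linPred X β - linPred X β'‖ := by
  obtain ⟨C, hC, h⟩ := abs_multivariateGaussian_real_sub_le (sigmaMatrix_posDef X hQ)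
  set T := (toEuclideanLin ((sigmaMatrix X Q)⁻¹ * Xᵀ)).toContinuousLinearMap
  refine ⟨C * ‖T‖, by positivity, fun s hs β β' => ?_⟩
  have hcomp : ∀ β, (acKernel X Y Q v β).real s
      = ∫ z, (coefKernel X Q v z).real s ∂latentKernel X Y β := fun β => by
    rw [acKernel, Kernel.comp_apply, bind_real_apply _ _ hs]
  rw [hcomp, hcomp]
  refine abs_integral_latentKernel_sub_le X Y (C := 1) (measurable_kernel_real _ hs)
    (by positivity) (fun z => ?_) (fun z z' => ?_) β β'
  · rw [abs_of_nonneg measureReal_nonneg]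
    exact measureReal_le_one
  · refine (h _ _ s hs).trans ?_
    rw [mul_assoc]
    refine mul_le_mul_of_nonneg_left ?_ hC
    have hd : condMean X Q v z - condMean X Q v z' = T (WithLp.toLp 2 (z - z')) := by
      rw [condMean, condMean, ← WithLp.toLp_sub, ← mulVec_sub, add_sub_add_right_eq_sub,
        ← mulVec_sub, mulVec_mulVec]
      rfl
    rw [hd]
    exact T.le_opNorm _

theorem exists_lipschitz_acKernel_pow_real (X : Matrix (Fin n) (Fin p) ℝ) (Y : Fin n → Bool)
    {Q : Matrix (Fin p) (Fin p) ℝ} (hQ : Q.PosDef) {c : ℝ} (hc : 0 < c)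
    (hX : lambdaMax (X * Q⁻¹ * Xᵀ) < c) (v : EuclideanSpace ℝ (Fin p)) :
    ∃ C : ℝ, 0 ≤ C ∧ ∀ (m : ℕ) (s), MeasurableSet s → ∀ β β',
      |((acKernel X Y Q v ^ (m + 1)) β).real s - ((acKernel X Y Q v ^ (m + 1)) β').real s|
        ≤ C * (c / (1 + c)) ^ m * ‖linPred X β - linPred X β'‖ := by
  obtain ⟨C, hC, h⟩ := exists_lipschitz_acKernel_real X Y hQ v
  refine ⟨C, hC, fun m s hs => ?_⟩
  induction m with
  | zero => simpa using h s hs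
  | succ m ih =>
    intro β β'
    have hM := isMarkovKernel_pow (acKernel X Y Q v) (m + 1)
    -- The first transition is split off, so that `ih` is the Lipschitz bound for the function being
    -- integrated.
    have hstep : ∀ β, ((acKernel X Y Q v ^ (m + 1 + 1)) β).real s
        = ∫ x, ((acKernel X Y Q v ^ (m + 1)) x).real s ∂acKernel X Y Q v β := fun β => by
      rw [pow_succ _ (m + 1), ← bind_real_apply _ _ hs]
      exact congrArg (fun μ : Measure _ => μ.real s) (Kernel.comp_apply _ _ _)
    rw [hstep, hstep, pow_succ (c / (1 + c)), ← mul_assoc]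
    refine abs_integral_acKernel_sub_le X Y hQ hc hX v (measurable_kernel_real _ hs)
      (fun β => ?_) (by positivity) ih β β'
    rw [abs_of_nonneg measureReal_nonneg]
    exact measureReal_le_one

theorem convergesAtRate_acKernel (X : Matrix (Fin n) (Fin p) ℝ) (Y : Fin n → Bool)
    {Q : Matrix (Fin p) (Fin p) ℝ} (hQ : Q.PosDef) {c : ℝ} (hc : 0 < c)
    (hX : lambdaMax (X * Q⁻¹ * Xᵀ) < c) (v : EuclideanSpace ℝ (Fin p)) :
    ConvergesAtRate (acKernel X Y Q v) (probitPosterior X Y Q v) (c / (1 + c)) := by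
  obtain ⟨C, hC, hLip⟩ := exists_lipschitz_acKernel_pow_real X Y hQ hc hX v
  have hprob := isProbabilityMeasure_probitPosterior X Y hQ v
  have hb : 0 < c / (1 + c) := by positivity
  set b := c / (1 + c)
  set π := probitPosterior X Y Q v
  have hintg : ∀ β, Integrable (fun β' => ‖linPred X β - linPred X β'‖) π := fun β => by
    set T := (toEuclideanLin X).toContinuousLinearMap
    have hT : ∀ β, linPred X β = T β := fun β => rfl
    refine Integrable.mono' ((integrable_const (‖T‖ * ‖β‖)).add
      ((integrable_norm_probitPosterior X Y hQ v).const_mul ‖T‖))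
      (continuous_const.sub (continuous_linPred X)).norm.aestronglyMeasurable
      (Filter.Eventually.of_forall fun β' => ?_)
    rw [norm_norm, hT, hT]
    exact (norm_sub_le _ _).trans (add_le_add (T.le_opNorm _) (T.le_opNorm _))
  have hI : ∀ β, 0 ≤ ∫ β', ‖linPred X β - linPred X β'‖ ∂π := fun β =>
    integral_nonneg fun _ => norm_nonneg _
  -- The `1` covers `m = 0`, where nothing has been smoothed; dividing by `b` pays for the step
  -- spent on smoothing.
  refine ⟨fun β => 1 + C / b * ∫ β', ‖linPred X β - linPred X β'‖ ∂π,
    fun β => by have := hI β; positivity, fun β m => tvDist_le_of_forall fun s hs => ?_⟩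
  have hM := isMarkovKernel_pow (acKernel X Y Q v) m
  rcases m with _ | m
  · refine (abs_real_sub_real_le_one _ _ s).trans ?_
    rw [pow_zero, mul_one]
    have := hI β
    have : 0 ≤ C / b * ∫ β', ‖linPred X β - linPred X β'‖ ∂π := by positivity
    linarith
  -- By invariance `π` is an average of the laws of chains started from `β'`, to which the Lipschitz
  -- bound applies.
  · have hstat : π.real s = ∫ β', ((acKernel X Y Q v ^ (m + 1)) β').real s ∂π := by
      rw [← bind_real_apply _ _ hs,
        bind_pow_of_bind_eq (invariant_acKernel_probitPosterior X Y hQ v)]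
    have hconst : ((acKernel X Y Q v ^ (m + 1)) β).real s
        = ∫ _, ((acKernel X Y Q v ^ (m + 1)) β).real s ∂π := by simp
    have hKi : Integrable (fun β' => ((acKernel X Y Q v ^ (m + 1)) β').real s) π :=
      Integrable.of_bound (measurable_kernel_real _ hs).aestronglyMeasurable 1
        (Filter.Eventually.of_forall fun β' => by
          rw [Real.norm_eq_abs, abs_of_nonneg measureReal_nonneg]
          exact measureReal_le_one)
    rw [hstat, hconst, ← integral_sub (integrable_const _) hKi]
    calc _ ≤ ∫ β', |((acKernel X Y Q v ^ (m + 1)) β).real s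
          - ((acKernel X Y Q v ^ (m + 1)) β').real s| ∂π := abs_integral_le_integral_abs
      _ ≤ ∫ β', C * b ^ m * ‖linPred X β - linPred X β'‖ ∂π :=
          integral_mono ((integrable_const _).sub hKi).abs ((hintg β).const_mul _)
            fun β' => hLip m s hs β β'
      _ = C / b * (∫ β', ‖linPred X β - linPred X β'‖ ∂π) * b ^ (m + 1) := by
          rw [integral_const_mul]
          field_simp
          ring
      _ ≤ _ := by
          gcongr
          linarith

theorem acRate_le (X : Matrix (Fin n) (Fin p) ℝ) (Y : Fin n → Bool)
    {Q : Matrix (Fin p) (Fin p) ℝ} (hQ : Q.PosDef) {c : ℝ} (hc : 0 < c)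
    (hX : lambdaMax (X * Q⁻¹ * Xᵀ) < c) (v : EuclideanSpace ℝ (Fin p)) :
    acRate v Q X Y ≤ c / (1 + c) :=
  csInf_le ⟨0, fun _ h => h.1.1⟩ ⟨⟨by positivity, (div_le_one (by linarith)).2 (by linarith)⟩,
    convergesAtRate_acKernel X Y hQ hc hX v⟩

end Convergence

theorem theorem3 (n : ℕ) (Y : Fin n → Bool) (p₀ : ℕ)
    (X : (p : ℕ) → Matrix (Fin n) (Fin p) ℝ) (Q : (p : ℕ) → Matrix (Fin p) (Fin p) ℝ)
    (hQ : ∀ p, p₀ ≤ p → (Q p).PosDef)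
    (hB1 : ∀ p, p₀ ≤ p → (X p).rank = n)
    (hB2 : ∃ c : ℝ, 0 < c ∧ ∀ p, p₀ ≤ p → lambdaMax (X p * (Q p)⁻¹ * (X p)ᵀ) < c) :
    ∃ ρ : ℝ, ρ < 1 ∧ ∀ v : (p : ℕ) → EuclideanSpace ℝ (Fin p),
      ∀ p, p₀ ≤ p → acRate (v p) (Q p) (X p) Y ≤ ρ := by
  obtain ⟨c, hc, hX⟩ := hB2
  exact ⟨c / (1 + c), (div_lt_one (by linarith)).2 (by linarith), fun v p hp =>
    acRate_le (X p) Y (hQ p hp) hc (hX p hp) (v p)⟩
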